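/- An operator space is a complex vector space $X$ with a norm $\|\cdot\|_n$ on each matrix space $\mathbb M_n(X)$ such that $(\mathbb M_1(X),\|\cdot\|_1)$ is a Banach space, $\|x\oplus y\|_{m+n}=\max\{\|x\|_m,\|y\|_n\}$, and $\|\alpha x\beta\|_m\le\|\alpha\|\,\|x\|_m\,\|\beta\|$ for all $x\in\mathbb M_m(X)$, $y\in\mathbb M_n(X)$ and all scalar matrices $\alpha,\beta\in M_m=B(\mathbb C^m)$. Let $\mathbf{OS}$ be the category of operator spaces and linear complete contractions (linear maps $u$ all of whose entrywise amplifications $\mathbb M_n(X)\to\mathbb M_n(Y)$ are contractions). For a Hilbert space $H$, let $T(H)$ be the space of trace-class operators on $H$ with the operator space structure inherited from the embedding $T(H)\to B(H)^*$, $x\mapsto \operatorname{tr}(x\,\cdot)$; explicitly, for $[x_{ij}]\in\mathbb M_n(T(H))$, $$\|[x_{ij}]\|_n=\sup\bigl\{\|[\operatorname{tr}(x_{ij}b_{kl})]\|_{M_{nm}} : m\in\mathbb N,\ [b_{kl}]\in M_m(B(H))=B(H^{\oplus m}),\ \|[b_{kl}]\|\le 1\bigr\}.$$ Put $T_n=T(\mathbb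 C^n)$ and $\ell_2=\ell^2(\mathbb N)$. For a family $(X_\lambda)$ of operator spaces, let $\bigoplus^1_\lambda X_\lambda$ be its $\ell^1$-direct sum with the operator space structure inherited from its embedding into $\bigl(\bigoplus^\infty_\lambda X_\lambda^*\bigr)^*$; explicitly, $\|[x_{ij}]\|_n$ is the supremum of $\|[\sum_\lambda\varphi_\lambda((x_{ij})_\lambda)]\|_{M_{nm}}$ over all $m\in\mathbb N$ and all families of complete contractions $\varphi_\lambda\colon X_\lambda\to M_m$. A set $\mathcal S$ of objects of a category is a strong generating set if (i) for any distinct parallel morphisms $f,g\colon A\to B$ there are $S\in\mathcal S$ and $s\colon S\to A$ with $f\circ s\ne g\circ s$, and (ii) for any monomorphism $m\colon A\to B$ that is not an isomorphism there are $S\in\mathcal S$ and $f\colon S\to B$ that does not factor through $m$. An object $S$ is a strong generator if $\{S\}$ is a strong generating set. Proposition. Each of the following is a strong generator (respectively, strong generating set) of $\mathbf{OS}$: (1) the set $\{T_n \mid n\in\mathbb N\}$; (2) the operator space $\bigoplus^1_{n\in\mathbb N}T_n$; (3) the operator space $T(\ell_2)$. -/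

import Mathlib

open CategoryTheory

universe u

noncomputable section

namespace OpSpace

open scoped Matrix.Norms.L2Operator

/-! ### Abstract operator spaces -/

/-- The block-diagonal sum `x ⊕ y ∈ 𝕄_{m+n}(X)` of `x ∈ 𝕄_m(X)` and `y ∈ 𝕄_n(X)`. -/
def dirSum {X : Type*} [Zero X] {m n : ℕ} (x : Matrix (Fin m) (Fin m) X)
    (y : Matrix (Fin n) (Fin n) X) : Matrix (Fin (m + n)) (Fin (m + n)) X :=
  Matrix.reindex finSumFinEquiv finSumFinEquiv (Matrix.fromBlocks x 0 0 y)

/-- The product `α x β ∈ 𝕄_m(X)` of scalar matrices `α, β` with `x ∈ 𝕄_m(X)`. -/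
def scalarMul {X : Type*} [AddCommGroup X] [Module ℂ X] {m : ℕ} (α : Matrix (Fin m) (Fin m) ℂ)
    (x : Matrix (Fin m) (Fin m) X) (β : Matrix (Fin m) (Fin m) ℂ) : Matrix (Fin m) (Fin m) X :=
  Matrix.of fun i j => ∑ k, ∑ l, (α i k * β l j) • x k l

/-- The `1 × 1` matrix with entry `x`. -/
def single {X : Type*} (x : X) : Matrix (Fin 1) (Fin 1) X := Matrix.of fun _ _ => x

/-- An (abstract) operator space structure on a complex vector space `X`: a norm on each matrix
space `𝕄_n(X)` such that `𝕄_1(X)` is a Banach space, `‖x ⊕ y‖ = max ‖x‖ ‖y‖` and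
`‖α x β‖ ≤ ‖α‖ ‖x‖ ‖β‖`. The norm of a scalar matrix is its norm as an operator on the Hilbert
space `ℂ^m`. -/
class OperatorSpace (X : Type*) [AddCommGroup X] [Module ℂ X] where
  /-- the norm on `𝕄_n(X)` -/
  matNorm : (n : ℕ) → Seminorm ℂ (Matrix (Fin n) (Fin n) X)
  eq_zero_of_matNorm_eq_zero : ∀ (n : ℕ) (x : Matrix (Fin n) (Fin n) X), matNorm n x = 0 → x = 0
  complete : ∀ a : ℕ → X,
    (∀ ε : ℝ, 0 < ε → ∃ N, ∀ p ≥ N, ∀ q ≥ N, matNorm 1 (single (a p - a q)) < ε) →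
    ∃ x : X, Filter.Tendsto (fun p => matNorm 1 (single (a p - x))) Filter.atTop (nhds 0)
  matNorm_dirSum : ∀ (m n : ℕ) (x : Matrix (Fin m) (Fin m) X) (y : Matrix (Fin n) (Fin n) X),
    matNorm (m + n) (dirSum x y) = max (matNorm m x) (matNorm n y)
  matNorm_scalarMul_le : ∀ (m : ℕ) (α : Matrix (Fin m) (Fin m) ℂ) (x : Matrix (Fin m) (Fin m) X)
    (β : Matrix (Fin m) (Fin m) ℂ), matNorm m (scalarMul α x β) ≤ ‖α‖ * matNorm m x * ‖β‖

open OperatorSpace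

/-- A linear map is a complete contraction if all its amplifications are contractions. -/
def IsCompleteContraction {X Y : Type*} [AddCommGroup X] [Module ℂ X] [OperatorSpace X]
    [AddCommGroup Y] [Module ℂ Y] [OperatorSpace Y] (f : X →ₗ[ℂ] Y) : Prop :=
  ∀ (n : ℕ) (x : Matrix (Fin n) (Fin n) X), matNorm n (x.map f) ≤ matNorm n x

/-- An operator space (with its underlying complex vector space). -/
structure OS where
  /-- the underlying set -/
  carrier : Type u
  [addCommGroup : AddCommGroup carrier]
  [module : Module ℂ carrier]
  [operatorSpace : OperatorSpace carrier]

namespace OS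

instance : CoeSort OS.{u} (Type u) := ⟨OS.carrier⟩

attribute [instance] OS.addCommGroup OS.module OS.operatorSpace

/-- The morphisms of `OS`: linear complete contractions. -/
@[ext]
structure Hom (X Y : OS.{u}) where
  /-- the underlying linear map -/
  toLinearMap : X →ₗ[ℂ] Y
  isCompleteContraction : IsCompleteContraction toLinearMap

/-- The category of operator spaces and linear complete contractions. -/
instance : Category OS.{u} where
  Hom := Hom
  id X := ⟨LinearMap.id, fun _ _ => le_rfl⟩
  comp f g := ⟨g.toLinearMap ∘ₗ f.toLinearMap, fun n x =>
    (g.isCompleteContraction n (x.map f.toLinearMap)).trans (f.isCompleteContraction n x)⟩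

end OS

/-! ### The norm of scalar (block) matrices -/

section L2

variable {ι κ : Type*} [Fintype ι] [Fintype κ] [DecidableEq κ]

lemma sum_norm_mulVec_sq_le (A : Matrix ι κ ℂ) (v : κ → ℂ) :
    ∑ i, ‖A.mulVec v i‖ ^ 2 ≤ ‖A‖ ^ 2 * ∑ j, ‖v j‖ ^ 2 := by
  have h := Matrix.l2_opNorm_mulVec A (WithLp.toLp 2 v)
  have h2 := pow_le_pow_left₀ (norm_nonneg _) h 2
  rw [mul_pow, EuclideanSpace.norm_sq_eq, EuclideanSpace.norm_sq_eq] at h2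
  simpa using h2

lemma l2_norm_le (A : Matrix ι κ ℂ) {C : ℝ} (hC : 0 ≤ C)
    (h : ∀ v : κ → ℂ, ∑ i, ‖A.mulVec v i‖ ^ 2 ≤ C ^ 2 * ∑ j, ‖v j‖ ^ 2) : ‖A‖ ≤ C := by
  rw [Matrix.l2_opNorm_def]
  refine ContinuousLinearMap.opNorm_le_bound _ hC fun v => ?_
  refine le_of_sq_le_sq ?_ (by positivity) 
  rw [mul_pow, EuclideanSpace.norm_sq_eq, EuclideanSpace.norm_sq_eq]
  simpa using h v.ofLp

lemma norm_entry_le [DecidableEq ι] (A : Matrix ι κ ℂ) (i : ι) (j : κ) : ‖A i j‖ ≤ ‖A‖ := by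
  have h := sum_norm_mulVec_sq_le A (Pi.single j 1)
  have h1 : ∑ k, ‖(Pi.single j 1 : κ → ℂ) k‖ ^ 2 = 1 := by
    rw [Finset.sum_eq_single j] <;> simp +contextual
  rw [h1, mul_one] at h
  refine le_of_sq_le_sq ((Finset.single_le_sum (f := fun i => ‖A.mulVec (Pi.single j 1) i‖ ^ 2)
    (fun _ _ => by positivity) (Finset.mem_univ i)).trans h |>.trans' ?_) (norm_nonneg _)
  simp

end L2

variable {m n k : ℕ}

/-- An `n × n` matrix of `m × m` matrices, viewed as an `nm × nm` matrix. -/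
abbrev flat (x : Matrix (Fin n) (Fin n) (Matrix (Fin m) (Fin m) ℂ)) :
    Matrix (Fin n × Fin m) (Fin n × Fin m) ℂ :=
  Matrix.comp _ _ _ _ _ x

lemma flat_add (x y : Matrix (Fin n) (Fin n) (Matrix (Fin m) (Fin m) ℂ)) :
    flat (x + y) = flat x + flat y := rfl

lemma flat_smul (c : ℂ) (x : Matrix (Fin n) (Fin n) (Matrix (Fin m) (Fin m) ℂ)) :
    flat (c • x) = c • flat x := rfl

lemma flat_mulVec (x : Matrix (Fin n) (Fin n) (Matrix (Fin m) (Fin m) ℂ)) (v : Fin n × Fin m → ℂ)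
    (p : Fin n × Fin m) :
    (flat x).mulVec v p = ∑ j, (x p.1 j).mulVec (fun l => v (j, l)) p.2 := by
  simp [Matrix.mulVec, dotProduct, Fintype.sum_prod_type, Matrix.comp_apply]

lemma norm_entry_le_flat (x : Matrix (Fin n) (Fin n) (Matrix (Fin m) (Fin m) ℂ)) (i j : Fin n) :
    ‖x i j‖ ≤ ‖flat x‖ := by
  refine l2_norm_le _ (norm_nonneg _) fun v => ?_
  have h := sum_norm_mulVec_sq_le (flat x) (fun p => if p.1 = j then v p.2 else 0)
  have e : ∀ p, (flat x).mulVec (fun p => if p.1 = j then v p.2 else 0) p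
      = (x p.1 j).mulVec v p.2 := by
    intro p
    rw [flat_mulVec, Finset.sum_eq_single j]
    · simp
    · intro b _ hb
      simp [hb, Matrix.mulVec, dotProduct]
    · simp
  simp only [e, Fintype.sum_prod_type] at h
  have e2 : ∑ a : Fin n, ∑ b : Fin m, ‖(if a = j then v b else 0)‖ ^ 2 = ∑ b, ‖v b‖ ^ 2 := by
    rw [Finset.sum_eq_single j]
    · simp
    · intro b _ hb
      simp [hb]
    · simp
  rw [e2] at h
  refine le_trans ?_ h
  exact Finset.single_le_sum (f := fun a => ∑ b, ‖(x a j).mulVec v b‖ ^ 2)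
    (fun _ _ => by positivity) (Finset.mem_univ i)

lemma norm_flat_le_sum (x : Matrix (Fin n) (Fin n) (Matrix (Fin m) (Fin m) ℂ)) :
    ‖flat x‖ ≤ ∑ i, ∑ j, ‖x i j‖ := by
  have e : flat x = ∑ i, ∑ j, flat (Matrix.of fun a b => if a = i ∧ b = j then x i j else 0) := by
    ext p q
    simp only [Matrix.sum_apply, Matrix.comp_apply, Matrix.of_apply]
    rw [Finset.sum_eq_single p.1, Finset.sum_eq_single q.1]
    · simp
    · intro b _ hb
      simp [hb.symm]
    · simp
    · intro b _ hb
      simp [hb.symm]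
    · simp
  rw [e]
  refine (norm_sum_le _ _).trans (Finset.sum_le_sum fun i _ => (norm_sum_le _ _).trans
    (Finset.sum_le_sum fun j _ => ?_))
  refine l2_norm_le _ (norm_nonneg _) fun v => ?_
  have e : ∀ a b, (flat (Matrix.of fun a b => if a = i ∧ b = j then x i j else 0)).mulVec v (a, b)
      = if a = i then (x i j).mulVec (fun l => v (j, l)) b else 0 := by
    intro a b
    rw [flat_mulVec, Finset.sum_eq_single j]
    · by_cases h : a = i <;> simp [h]
    · intro b _ hb
      simp [hb]
    · simp
  simp only [Fintype.sum_prod_type, e]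
  rw [Finset.sum_eq_single i]
  · simp only [if_true]
    refine (sum_norm_mulVec_sq_le (x i j) _).trans ?_
    gcongr
    exact Finset.single_le_sum (f := fun a => ∑ b, ‖v (a, b)‖ ^ 2)
      (fun _ _ => by positivity) (Finset.mem_univ j)
  · intro b _ hb
    simp [hb]
  · simp

lemma norm_flat_single (a : Matrix (Fin m) (Fin m) ℂ) : ‖flat (single a)‖ = ‖a‖ := by
  refine le_antisymm ((norm_flat_le_sum _).trans (by simp [single])) ?_
  exact norm_entry_le_flat (single a) 0 0

lemma norm_flat_dirSum (x : Matrix (Fin n) (Fin n) (Matrix (Fin m) (Fin m) ℂ))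
    (y : Matrix (Fin k) (Fin k) (Matrix (Fin m) (Fin m) ℂ)) :
    ‖flat (dirSum x y)‖ = max ‖flat x‖ ‖flat y‖ := by
  have eL : ∀ (v : Fin (n + k) × Fin m → ℂ) a b,
      (flat (dirSum x y)).mulVec v (Fin.castAdd k a, b)
        = (flat x).mulVec (fun p => v (Fin.castAdd k p.1, p.2)) (a, b) := by
    intro v a b
    rw [flat_mulVec, flat_mulVec, Fin.sum_univ_add]
    simp [dirSum, finSumFinEquiv]
  have eR : ∀ (v : Fin (n + k) × Fin m → ℂ) a b,
      (flat (dirSum x y)).mulVec v (Fin.natAdd n a, b)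
        = (flat y).mulVec (fun p => v (Fin.natAdd n p.1, p.2)) (a, b) := by
    intro v a b
    rw [flat_mulVec, flat_mulVec, Fin.sum_univ_add]
    simp [dirSum, finSumFinEquiv]
  refine le_antisymm ?_ (max_le ?_ ?_)
  · refine l2_norm_le _ (le_max_of_le_left (norm_nonneg _)) fun v => ?_
    rw [Fintype.sum_prod_type, Fintype.sum_prod_type, Fin.sum_univ_add, Fin.sum_univ_add]
    simp only [eL, eR]
    have h1 := sum_norm_mulVec_sq_le (flat x) (fun p => v (Fin.castAdd k p.1, p.2))
    have h2 := sum_norm_mulVec_sq_le (flat y) (fun p => v (Fin.natAdd n p.1, p.2))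
    rw [Fintype.sum_prod_type, Fintype.sum_prod_type] at h1 h2
    rw [mul_add]
    refine add_le_add (h1.trans ?_) (h2.trans ?_)
    · gcongr; exact le_max_left _ _
    · gcongr; exact le_max_right _ _
  · refine l2_norm_le _ (norm_nonneg _) fun v => ?_
    have h := sum_norm_mulVec_sq_le (flat (dirSum x y))
      (fun p => Fin.addCases (fun a => v (a, p.2)) (fun _ => 0) p.1)
    rw [Fintype.sum_prod_type, Fintype.sum_prod_type, Fin.sum_univ_add, Fin.sum_univ_add] at h
    simp only [eL, eR] at h
    rw [Fintype.sum_prod_type, Fintype.sum_prod_type]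
    simp only [Fin.addCases_left, Fin.addCases_right] at h
    refine le_trans (le_add_of_nonneg_right (by positivity)) (h.trans (by simp))
  · refine l2_norm_le _ (norm_nonneg _) fun v => ?_
    have h := sum_norm_mulVec_sq_le (flat (dirSum x y))
      (fun p => Fin.addCases (fun _ => 0) (fun a => v (a, p.2)) p.1)
    rw [Fintype.sum_prod_type, Fintype.sum_prod_type, Fin.sum_univ_add, Fin.sum_univ_add] at h
    simp only [eL, eR] at h
    rw [Fintype.sum_prod_type, Fintype.sum_prod_type]
    simp only [Fin.addCases_left, Fin.addCases_right] at h
    refine le_trans (le_add_of_nonneg_left (by positivity)) (h.trans (by simp))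

lemma norm_kronecker_one_le (α : Matrix (Fin n) (Fin n) ℂ) :
    ‖Matrix.kroneckerMap (· * ·) α (1 : Matrix (Fin m) (Fin m) ℂ)‖ ≤ ‖α‖ := by
  refine l2_norm_le _ (norm_nonneg _) fun v => ?_
  have e : ∀ a b, (Matrix.kroneckerMap (· * ·) α (1 : Matrix (Fin m) (Fin m) ℂ)).mulVec v (a, b)
      = α.mulVec (fun a => v (a, b)) a := by
    intro a b
    simp [Matrix.mulVec, dotProduct, Fintype.sum_prod_type, Matrix.one_apply]
  simp only [Fintype.sum_prod_type_right, e, Finset.mul_sum (s := Finset.univ (α := Fin m))]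
  exact Finset.sum_le_sum fun b _ => sum_norm_mulVec_sq_le α (fun a => v (a, b))

lemma flat_scalarMul (α : Matrix (Fin n) (Fin n) ℂ)
    (x : Matrix (Fin n) (Fin n) (Matrix (Fin m) (Fin m) ℂ)) (β : Matrix (Fin n) (Fin n) ℂ) :
    flat (scalarMul α x β) = Matrix.kroneckerMap (· * ·) α (1 : Matrix (Fin m) (Fin m) ℂ) * flat x *
      Matrix.kroneckerMap (· * ·) β (1 : Matrix (Fin m) (Fin m) ℂ) := by
  ext ⟨a, b⟩ ⟨c, d⟩
  simp [Matrix.mul_apply, Fintype.sum_prod_type, Matrix.comp_apply, scalarMul, Matrix.sum_apply,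
    Matrix.one_apply, Finset.sum_mul]
  rw [Finset.sum_comm]
  exact Finset.sum_congr rfl fun i _ => Finset.sum_congr rfl fun j _ => by ring

lemma norm_flat_scalarMul_le (α : Matrix (Fin n) (Fin n) ℂ)
    (x : Matrix (Fin n) (Fin n) (Matrix (Fin m) (Fin m) ℂ)) (β : Matrix (Fin n) (Fin n) ℂ) :
    ‖flat (scalarMul α x β)‖ ≤ ‖α‖ * ‖flat x‖ * ‖β‖ := by
  rw [flat_scalarMul]
  refine (Matrix.l2_opNorm_mul _ _).trans ?_
  refine mul_le_mul ((Matrix.l2_opNorm_mul _ _).trans ?_) (norm_kronecker_one_le β)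
    (norm_nonneg _) (by positivity)
  exact mul_le_mul_of_nonneg_right (norm_kronecker_one_le α) (norm_nonneg _)

/-- The operator space `M_m` of scalar matrices: `M_n(M_m) = M_{nm}`. -/
instance : OperatorSpace (Matrix (Fin m) (Fin m) ℂ) where
  matNorm n := Seminorm.of (fun x => ‖flat x‖) (fun x y => norm_add_le (flat x) (flat y))
    (fun c x => norm_smul c (flat x))
  eq_zero_of_matNorm_eq_zero n x h := by
    have : flat x = 0 := norm_eq_zero.1 h
    exact (Matrix.comp _ _ _ _ _).injective this
  complete a ha := by
    have hc : CauchySeq a := Metric.cauchySeq_iff.2 fun ε hε => by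
      obtain ⟨N, hN⟩ := ha ε hε
      exact ⟨N, fun p hp q hq => by
        rw [dist_eq_norm, ← norm_flat_single]; exact hN p hp q hq⟩
    obtain ⟨x, hx⟩ := cauchySeq_tendsto_of_complete hc
    refine ⟨x, ?_⟩
    have := tendsto_iff_norm_sub_tendsto_zero.1 hx
    exact this.congr fun p => (norm_flat_single _).symm
  matNorm_dirSum _ _ x y := norm_flat_dirSum x y
  matNorm_scalarMul_le _ α x β := norm_flat_scalarMul_le α x β

lemma matNorm_matrix (x : Matrix (Fin n) (Fin n) (Matrix (Fin m) (Fin m) ℂ)) :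
    matNorm n x = ‖flat x‖ := rfl

/-! ### Operator space structures inherited from matrix-valued linear maps -/

section OfTests

variable {X : Type*} [AddCommGroup X] [Module ℂ X] {I : Type*} {s : I → ℕ}
  (φ : ∀ i, X →ₗ[ℂ] Matrix (Fin (s i)) (Fin (s i)) ℂ)

/-- `sup_i ‖(φ_i)_n(x)‖` for `x ∈ 𝕄_n(X)` and linear maps `φ_i : X → M_{s i}`. -/
def supNorm (n : ℕ) (x : Matrix (Fin n) (Fin n) X) : ℝ := ⨆ i, matNorm n (x.map (φ i))

lemma bddAbove_supNorm {φ : ∀ i, X →ₗ[ℂ] Matrix (Fin (s i)) (Fin (s i)) ℂ}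
    (hb : ∀ x : X, ∃ C : ℝ, ∀ i, ‖φ i x‖ ≤ C) (n : ℕ) (x : Matrix (Fin n) (Fin n) X) :
    BddAbove (Set.range fun i => matNorm n (x.map (φ i))) := by
  choose C hC using hb
  refine ⟨∑ a, ∑ b, C (x a b), ?_⟩
  rintro _ ⟨i, rfl⟩
  exact (norm_flat_le_sum _).trans (Finset.sum_le_sum fun a _ => Finset.sum_le_sum fun b _ =>
    hC (x a b) i)

lemma matNorm_map_le_supNorm {φ : ∀ i, X →ₗ[ℂ] Matrix (Fin (s i)) (Fin (s i)) ℂ}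
    (hb : ∀ x : X, ∃ C : ℝ, ∀ i, ‖φ i x‖ ≤ C) (n : ℕ) (x : Matrix (Fin n) (Fin n) X) (i : I) :
    matNorm n (x.map (φ i)) ≤ supNorm φ n x :=
  le_ciSup (bddAbove_supNorm hb n x) i

lemma supNorm_nonneg (n : ℕ) (x : Matrix (Fin n) (Fin n) X) : 0 ≤ supNorm φ n x :=
  Real.iSup_nonneg fun _ => apply_nonneg _ _

lemma supNorm_le {n : ℕ} {x : Matrix (Fin n) (Fin n) X} {C : ℝ} (hC : 0 ≤ C)
    (h : ∀ i, matNorm n (x.map (φ i)) ≤ C) : supNorm φ n x ≤ C :=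
  Real.iSup_le h hC

lemma map_scalarMul {Y : Type*} [AddCommGroup Y] [Module ℂ Y] (f : X →ₗ[ℂ] Y) {m : ℕ}
    (α : Matrix (Fin m) (Fin m) ℂ) (x : Matrix (Fin m) (Fin m) X) (β : Matrix (Fin m) (Fin m) ℂ) :
    (scalarMul α x β).map f = scalarMul α (x.map f) β := by
  ext i j : 2
  simp [scalarMul]

lemma map_dirSum {Y : Type*} [AddCommGroup Y] [Module ℂ Y] (f : X →ₗ[ℂ] Y) {m n : ℕ}
    (x : Matrix (Fin m) (Fin m) X) (y : Matrix (Fin n) (Fin n) X) :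
    (dirSum x y).map f = dirSum (x.map f) (y.map f) := by
  ext i j : 2
  refine Fin.addCases (fun a => ?_) (fun a => ?_) i <;>
  refine Fin.addCases (fun b => ?_) (fun b => ?_) j <;> simp [dirSum, finSumFinEquiv]

lemma matNorm_single_matrix {m : ℕ} (a : Matrix (Fin m) (Fin m) ℂ) :
    matNorm 1 (single a) = ‖a‖ := norm_flat_single a

/-- The operator space structure `‖x‖_n = sup_i ‖(φ_i)_n(x)‖` given by a pointwise bounded,
separating family of linear maps `φ_i : X → M_{s i}`, provided that `X` is complete. -/
@[reducible]
def ofTests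
    (hb : ∀ x : X, ∃ C : ℝ, ∀ i, ‖φ i x‖ ≤ C)
    (hsep : ∀ x : X, (∀ i, φ i x = 0) → x = 0)
    (hc : ∀ a : ℕ → X, (∀ ε : ℝ, 0 < ε → ∃ N, ∀ p ≥ N, ∀ q ≥ N, ∀ i, ‖φ i (a p - a q)‖ ≤ ε) →
      ∃ x : X, ∀ ε : ℝ, 0 < ε → ∃ N, ∀ p ≥ N, ∀ i, ‖φ i (a p - x)‖ ≤ ε) :
    OperatorSpace X where
  matNorm n := Seminorm.of (supNorm φ n)
    (fun x y => supNorm_le φ (add_nonneg (supNorm_nonneg φ n x) (supNorm_nonneg φ n y)) fun i => by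
      rw [Matrix.map_add _ (map_add (φ i))]
      exact (map_add_le_add _ _ _).trans (add_le_add (matNorm_map_le_supNorm hb n x i)
        (matNorm_map_le_supNorm hb n y i)))
    (fun c x => by
      rw [supNorm, supNorm, Real.mul_iSup_of_nonneg (norm_nonneg c)]
      refine iSup_congr fun i => ?_
      rw [Matrix.map_smul _ c (map_smul (φ i) c), map_smul_eq_mul])
  eq_zero_of_matNorm_eq_zero n x h := by
    ext a b
    refine hsep _ fun i => ?_
    have h1 : matNorm n (x.map (φ i)) = 0 :=
      le_antisymm ((matNorm_map_le_supNorm hb n x i).trans_eq h) (apply_nonneg _ _)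
    exact congrFun (congrFun (eq_zero_of_matNorm_eq_zero _ _ h1) a) b
  complete a ha := by
    obtain ⟨x, hx⟩ := hc a fun ε hε => by
      obtain ⟨N, hN⟩ := ha ε hε
      refine ⟨N, fun p hp q hq i => ?_⟩
      rw [← matNorm_single_matrix]
      exact (matNorm_map_le_supNorm hb 1 (single (a p - a q)) i).trans (hN p hp q hq).le
    refine ⟨x, ?_⟩
    rw [Metric.tendsto_atTop]
    intro ε hε
    obtain ⟨N, hN⟩ := hx (ε / 2) (half_pos hε)
    refine ⟨N, fun p hp => ?_⟩
    rw [Real.dist_eq, sub_zero, abs_of_nonneg (apply_nonneg _ _)]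
    refine lt_of_le_of_lt (supNorm_le φ (half_pos hε).le fun i => ?_) (half_lt_self hε)
    exact (matNorm_single_matrix (φ i (a p - x))).trans_le (hN p hp i)
  matNorm_dirSum m n x y := by
    refine le_antisymm (supNorm_le φ (le_max_of_le_left (supNorm_nonneg φ m x)) fun i => ?_)
      (max_le (supNorm_le φ (supNorm_nonneg φ _ _) fun i => ?_)
        (supNorm_le φ (supNorm_nonneg φ _ _) fun i => ?_))
    · rw [map_dirSum, matNorm_dirSum]
      exact max_le_max (matNorm_map_le_supNorm hb m x i) (matNorm_map_le_supNorm hb n y i)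
    · refine le_trans ?_ (matNorm_map_le_supNorm hb _ _ i)
      rw [map_dirSum, matNorm_dirSum]
      exact le_max_left _ _
    · refine le_trans ?_ (matNorm_map_le_supNorm hb _ _ i)
      rw [map_dirSum, matNorm_dirSum]
      exact le_max_right _ _
  matNorm_scalarMul_le m α x β := by
    refine supNorm_le φ (mul_nonneg (mul_nonneg (norm_nonneg _) (supNorm_nonneg φ m x))
      (norm_nonneg _)) fun i => ?_
    rw [map_scalarMul]
    refine (matNorm_scalarMul_le m α _ β).trans ?_
    exact mul_le_mul_of_nonneg_right (mul_le_mul_of_nonneg_left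
      (matNorm_map_le_supNorm hb m x i) (norm_nonneg _)) (norm_nonneg _)

end OfTests

/-! ### The underlying Banach space of an operator space -/

section Banach

variable {X : Type*} [AddCommGroup X] [Module ℂ X] [OperatorSpace X]

/-- The linear isomorphism `ℂ → M_1`. -/
def scalarEmb : ℂ →ₗ[ℂ] Matrix (Fin 1) (Fin 1) ℂ where
  toFun := single
  map_add' _ _ := rfl
  map_smul' _ _ := rfl

lemma scalarEmb_apply (a : ℂ) (i j : Fin 1) : scalarEmb a i j = a := rfl

/-- Contractive functionals are complete contractions into `M_1`. -/
lemma isCompleteContraction_of_functional (f : X →ₗ[ℂ] ℂ)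
    (hf : ∀ x, ‖f x‖ ≤ matNorm 1 (single x)) :
    IsCompleteContraction (scalarEmb ∘ₗ f) := by
  intro n x
  set A : Matrix (Fin n) (Fin n) ℂ := x.map f with hA
  have key : ∀ v : Fin n → ℂ, ∑ i, ‖A.mulVec v i‖ ^ 2 ≤ (matNorm n x) ^ 2 * ∑ j, ‖v j‖ ^ 2 := by
    intro v
    rcases Nat.eq_zero_or_pos n with rfl | hn
    · simp
    obtain ⟨k, rfl⟩ : ∃ k, n = 1 + k := ⟨n - 1, by omega⟩
    set w : Fin (1 + k) → ℂ := A.mulVec v with hw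
    set y : X := ∑ i, ∑ j, (star (w i) * v j) • x i j with hy
    have hfy : f y = ((∑ i, ‖w i‖ ^ 2 : ℝ) : ℂ) := by
      have : ∀ i, ∑ j, star (w i) * v j * f (x i j) = star (w i) * w i := by
        intro i
        rw [show w i = ∑ j, A i j * v j from rfl, Finset.mul_sum]
        exact Finset.sum_congr rfl fun j _ => by rw [hA, Matrix.map_apply]; ring
      simp only [hy, map_sum, map_smul, smul_eq_mul, this, Complex.ofReal_sum]
      refine Finset.sum_congr rfl fun i _ => ?_
      rw [Complex.star_def, Complex.conj_mul']
      simp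
    let α : Matrix (Fin (1 + k)) (Fin (1 + k)) ℂ :=
      Matrix.of fun i j => if i = Fin.castAdd k 0 then star (w j) else 0
    let β : Matrix (Fin (1 + k)) (Fin (1 + k)) ℂ :=
      Matrix.of fun i j => if j = Fin.castAdd k 0 then v i else 0
    have hα : ‖α‖ ≤ Real.sqrt (∑ i, ‖w i‖ ^ 2) := by
      refine l2_norm_le _ (Real.sqrt_nonneg _) fun u => ?_
      rw [Real.sq_sqrt (by positivity), Finset.sum_eq_single (Fin.castAdd k 0)]
      · have h1 : α.mulVec u (Fin.castAdd k 0) = ∑ j, star (w j) * u j := by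
          simp [α, Matrix.mulVec, dotProduct]
        rw [h1]
        refine (pow_le_pow_left₀ (norm_nonneg _) (norm_sum_le _ _) 2).trans ?_
        simp only [norm_mul, norm_star]
        exact Finset.sum_mul_sq_le_sq_mul_sq _ _ _
      · intro b _ hb
        simp [α, Matrix.mulVec, dotProduct, hb]
      · simp
    have hβ : ‖β‖ ≤ Real.sqrt (∑ i, ‖v i‖ ^ 2) := by
      refine l2_norm_le _ (Real.sqrt_nonneg _) fun u => ?_
      have h1 : ∀ i, β.mulVec u i = v i * u (Fin.castAdd k 0) := by
        intro i
        simp [β, Matrix.mulVec, dotProduct]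
      simp only [Real.sq_sqrt (show 0 ≤ ∑ i, ‖v i‖ ^ 2 by positivity), h1, norm_mul, mul_pow,
        ← Finset.sum_mul]
      gcongr
      exact Finset.single_le_sum (f := fun a => ‖u a‖ ^ 2)
        (fun _ _ => by positivity) (Finset.mem_univ (Fin.castAdd k 0))
    have hd : scalarMul α x β = dirSum (single y) (0 : Matrix (Fin k) (Fin k) X) := by
      ext i j : 2
      refine Fin.addCases (fun a => ?_) (fun a => ?_) i <;>
      refine Fin.addCases (fun b => ?_) (fun b => ?_) j
      · have h1 : a = 0 := Subsingleton.elim _ _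
        have h2 : b = 0 := Subsingleton.elim _ _
        subst h1 h2
        simp [scalarMul, α, β, dirSum, finSumFinEquiv, single, hy]
      · have : Fin.natAdd 1 b ≠ Fin.castAdd k 0 := by
          intro h; have := congrArg Fin.val h; simp at this
        simp [scalarMul, β, dirSum, finSumFinEquiv, this]
      · have : Fin.natAdd 1 a ≠ Fin.castAdd k 0 := by
          intro h; have := congrArg Fin.val h; simp at this
        simp [scalarMul, α, dirSum, finSumFinEquiv, this]
      · have : Fin.natAdd 1 a ≠ Fin.castAdd k 0 := by
          intro h; have := congrArg Fin.val h; simp at this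
        simp [scalarMul, α, dirSum, finSumFinEquiv, this]
    have h1 : ∑ i, ‖w i‖ ^ 2 ≤ Real.sqrt (∑ i, ‖w i‖ ^ 2) * matNorm (1 + k) x *
        Real.sqrt (∑ i, ‖v i‖ ^ 2) := by
      calc ∑ i, ‖w i‖ ^ 2 = ‖f y‖ := by
            rw [hfy, Complex.norm_real, Real.norm_of_nonneg (by positivity)]
        _ ≤ matNorm 1 (single y) := hf y
        _ ≤ matNorm (1 + k) (scalarMul α x β) := by
            rw [hd, matNorm_dirSum]; exact le_max_left _ _
        _ ≤ ‖α‖ * matNorm (1 + k) x * ‖β‖ := matNorm_scalarMul_le _ _ _ _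
        _ ≤ _ := by gcongr
    set S := Real.sqrt (∑ i, ‖w i‖ ^ 2) with hS
    set T := Real.sqrt (∑ i, ‖v i‖ ^ 2) with hT
    have hS2 : ∑ i, ‖w i‖ ^ 2 = S ^ 2 := (Real.sq_sqrt (by positivity)).symm
    have hT2 : ∑ i, ‖v i‖ ^ 2 = T ^ 2 := (Real.sq_sqrt (by positivity)).symm
    have hN : 0 ≤ matNorm (1 + k) x := apply_nonneg _ _
    have hS0 : 0 ≤ S := Real.sqrt_nonneg _
    have hT0 : 0 ≤ T := Real.sqrt_nonneg _
    rw [hS2] at h1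
    rw [hS2, hT2, ← mul_pow]
    refine pow_le_pow_left₀ hS0 ?_ 2
    rcases hS0.eq_or_lt with h | h
    · rw [← h]; positivity
    · nlinarith
  refine l2_norm_le _ (apply_nonneg _ _) fun v => ?_
  have h := key (fun j => v (j, 0))
  have e : ∀ i, (flat (x.map (scalarEmb ∘ₗ f))).mulVec v (i, 0)
      = A.mulVec (fun j => v (j, 0)) i := by
    intro i
    rw [flat_mulVec]
    simp [Matrix.mulVec, dotProduct, hA, scalarEmb_apply]
  simp only [Fintype.sum_prod_type, Fin.sum_univ_one]
  rw [Finset.sum_congr rfl fun i _ => by rw [show (0 : Fin 1) = 0 from rfl, e i]]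
  exact h

end Banach

namespace OS

variable (X : OS.{u})

/-- The norm `‖x‖ = ‖x‖_1` of an operator space. -/
instance : Norm X := ⟨fun x => matNorm 1 (single x)⟩

lemma norm_def {X : OS.{u}} (x : X) : ‖x‖ = matNorm 1 (single x) := rfl

lemma normedSpaceCore : NormedSpace.Core ℂ X where
  norm_nonneg x := apply_nonneg (matNorm 1) (single x)
  norm_smul c x := map_smul_eq_mul (matNorm 1) c (single x)
  norm_triangle x y := map_add_le_add (matNorm 1) (single x) (single y)
  norm_eq_zero_iff x := by
    refine ⟨fun h => congrFun (congrFun (eq_zero_of_matNorm_eq_zero 1 _ h) 0) 0, ?_⟩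
    rintro rfl
    exact map_zero (matNorm 1)

instance : NormedAddCommGroup X := NormedAddCommGroup.ofCore (normedSpaceCore X)

instance : NormedSpace ℂ X := NormedSpace.ofCore (normedSpaceCore X)

instance : CompleteSpace X := by
  refine Metric.complete_of_cauchySeq_tendsto fun a ha => ?_
  obtain ⟨x, hx⟩ := complete a fun ε hε => by
    obtain ⟨N, hN⟩ := Metric.cauchySeq_iff.1 ha ε hε
    exact ⟨N, fun p hp q hq => (dist_eq_norm (a p) (a q)).symm.trans_lt (hN p hp q hq)⟩
  exact ⟨x, tendsto_iff_norm_sub_tendsto_zero.2 hx⟩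


end OS

/-! ### `ℓ¹`-direct sums -/

section L1Sum

variable {Λ : Type} (X : Λ → OS.{u})

/-- A test on `⊕¹ X_l`: a family of complete contractions `X_l → M_m`, that is, an element of the
closed unit ball of `M_m(⊕^∞ X_l^*) = ⊕^∞ CB(X_l, M_m)`. -/
structure L1Test where
  /-- the matrix size -/
  size : ℕ
  /-- the maps `X_l → M_m` -/
  map : ∀ l, X l →ₗ[ℂ] Matrix (Fin size) (Fin size) ℂ
  isCompleteContraction : ∀ l, IsCompleteContraction (map l)

variable {X}

lemma L1Test.norm_map_le (t : L1Test X) (l : Λ) (x : X l) : ‖t.map l x‖ ≤ ‖x‖ := by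
  rw [← matNorm_single_matrix]
  exact t.isCompleteContraction l 1 (single x)

lemma summable_norm_l1 (x : lp (fun l => X l) 1) : Summable fun l => ‖x l‖ := by
  have := (lp.memℓp x).summable (by norm_num)
  simpa using this

lemma L1Test.summable (t : L1Test X) (x : lp (fun l => X l) 1) :
    Summable fun l => t.map l (x l) :=
  Summable.of_norm_bounded (summable_norm_l1 x) fun l => t.norm_map_le l (x l)

/-- The linear map `⊕¹ X_l → M_m`, `x ↦ ∑_l φ_l(x_l)`. -/
def L1Test.toLinearMap (t : L1Test X) :
    lp (fun l => X l) 1 →ₗ[ℂ] Matrix (Fin t.size) (Fin t.size) ℂ where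
  toFun x := ∑' l, t.map l (x l)
  map_add' x y := by
    rw [← (t.summable x).tsum_add (t.summable y)]
    exact tsum_congr fun l => by simp
  map_smul' c x := by
    simp only [RingHom.id_apply]
    rw [← (t.summable x).tsum_const_smul]
    exact tsum_congr fun l => by simp

lemma norm_l1 (x : lp (fun l => X l) 1) : ‖x‖ = ∑' l, ‖x l‖ := by
  rw [lp.norm_eq_tsum_rpow (by norm_num)]
  simp

lemma L1Test.norm_toLinearMap_le (t : L1Test X) (x : lp (fun l => X l) 1) :
    ‖t.toLinearMap x‖ ≤ ‖x‖ := by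
  rw [norm_l1]
  refine tsum_of_norm_bounded (summable_norm_l1 x).hasSum fun l => t.norm_map_le l (x l)

lemma exists_l1Test (x : lp (fun l => X l) 1) : ∃ t : L1Test X, ‖t.toLinearMap x‖ = ‖x‖ := by
  choose g hg hgx using fun l => exists_dual_vector'' ℂ (x l)
  let t : L1Test X := ⟨1, fun l => scalarEmb ∘ₗ (g l).toLinearMap, fun l =>
    isCompleteContraction_of_functional _ fun y =>
      ((g l).le_of_opNorm_le (hg l) y).trans_eq (one_mul _)⟩
  refine ⟨t, ?_⟩
  have h : t.toLinearMap x = single (((∑' l, ‖x l‖ : ℝ)) : ℂ) := by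
    have h1 : HasSum (fun l => scalarEmb (((‖x l‖ : ℝ)) : ℂ)) (scalarEmb (((∑' l, ‖x l‖ : ℝ)) : ℂ)) :=
      (Complex.hasSum_ofReal.2 (summable_norm_l1 x).hasSum).mapL (LinearMap.toContinuousLinearMap scalarEmb)
    refine Eq.trans (tsum_congr fun l => ?_) h1.tsum_eq
    exact congrArg scalarEmb (hgx l)
  have h2 : 0 ≤ ∑' l, ‖x l‖ := tsum_nonneg fun _ => norm_nonneg _
  rw [h, norm_l1]
  refine le_antisymm ?_ ?_
  · refine l2_norm_le _ h2 fun v => ?_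
    simp [single, Matrix.mulVec, dotProduct, mul_pow, abs_of_nonneg h2]
  · refine le_trans ?_ (norm_entry_le _ 0 0)
    simp [single, abs_of_nonneg h2]

variable (X)

/-- The operator space structure on the Banach space `⊕¹ X_l`, inherited from its embedding into
the dual of `⊕^∞ X_l^*`: for `x ∈ 𝕄_n(⊕¹ X_l)`, the norm `‖x‖_n` is the supremum of
`‖[∑_l φ_l((x_{ij})_l)]‖` over all `m` and all families of complete contractions
`φ_l : X_l → M_m`. -/
instance l1OperatorSpace : OperatorSpace (lp (fun l => X l) 1) :=
  ofTests (fun t : L1Test X => t.toLinearMap)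
    (fun x => ⟨‖x‖, fun t => t.norm_toLinearMap_le x⟩)
    (fun x hx => by
      obtain ⟨t, ht⟩ := exists_l1Test x
      rw [hx t, norm_zero] at ht
      exact norm_eq_zero.1 ht.symm)
    (fun a ha => by
      have hc : CauchySeq a := Metric.cauchySeq_iff.2 fun ε hε => by
        obtain ⟨N, hN⟩ := ha (ε / 2) (half_pos hε)
        refine ⟨N, fun p hp q hq => ?_⟩
        obtain ⟨t, ht⟩ := exists_l1Test (a p - a q)
        rw [dist_eq_norm, ← ht]
        exact (hN p hp q hq t).trans_lt (half_lt_self hε)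
      obtain ⟨x, hx⟩ := cauchySeq_tendsto_of_complete hc
      refine ⟨x, fun ε hε => ?_⟩
      obtain ⟨N, hN⟩ := Metric.tendsto_atTop.1 hx ε hε
      exact ⟨N, fun p hp t => (t.norm_toLinearMap_le _).trans
        ((dist_eq_norm (a p) x).symm.trans_le (hN p hp).le)⟩)

/-- The `ℓ¹`-direct sum `⊕¹ X_l` of a family of operator spaces. -/
def OS.l1Sum : OS.{u} := ⟨lp (fun l => X l) 1⟩

end L1Sum

/-! ### Trace-class operators -/

section TraceClass

open ContinuousLinearMap

section HilbertSchmidt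

variable {H : Type*} [NormedAddCommGroup H] [InnerProductSpace ℂ H] {ι κ : Type*}

/-- The square of the Hilbert–Schmidt norm. -/
def hs (e : HilbertBasis ι ℂ H) (a : H →L[ℂ] H) : ENNReal := ∑' i, ‖a (e i)‖ₑ ^ 2

lemma enorm_sq_eq_tsum (f : HilbertBasis κ ℂ H) (v : H) :
    ‖v‖ₑ ^ 2 = ∑' j, ‖inner ℂ (f j) v‖ₑ ^ 2 := by
  have h : HasSum (fun j => ‖inner ℂ (f j) v‖ ^ 2) (‖v‖ ^ 2) := by
    have h := Complex.hasSum_re (f.hasSum_inner_mul_inner v v)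
    have e : ∀ j, (inner ℂ v (f j) * inner ℂ (f j) v).re = ‖inner ℂ (f j) v‖ ^ 2 := by
      intro j
      rw [← inner_conj_symm, Complex.conj_mul']
      norm_cast
    simp only [e] at h
    convert h using 1
    rw [inner_self_eq_norm_sq_to_K]
    norm_cast
  have e1 : ∀ x : ℝ, 0 ≤ x → ‖x‖ₑ ^ 2 = ENNReal.ofReal (x ^ 2) := by
    intro x hx
    rw [Real.enorm_of_nonneg hx, ENNReal.ofReal_pow hx]
  rw [← enorm_norm v, e1 _ (norm_nonneg _), ← h.tsum_eq,
    ENNReal.ofReal_tsum_of_nonneg (fun _ => by positivity) h.summable]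
  exact tsum_congr fun j => by rw [← e1 _ (norm_nonneg _), enorm_norm]

lemma hs_adjoint [CompleteSpace H] (e : HilbertBasis ι ℂ H) (f : HilbertBasis κ ℂ H)
    (a : H →L[ℂ] H) : hs f (adjoint a) = hs e a := by
  unfold hs
  simp only [enorm_sq_eq_tsum f (a _)]
  rw [ENNReal.tsum_comm]
  refine tsum_congr fun j => ?_
  rw [enorm_sq_eq_tsum e]
  refine tsum_congr fun i => ?_
  rw [adjoint_inner_right, ← inner_conj_symm, ← ofReal_norm, ← ofReal_norm, RCLike.norm_conj]

lemma hs_comp_left_le (e : HilbertBasis ι ℂ H) (b a : H →L[ℂ] H) :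
    hs e (b ∘L a) ≤ ‖b‖ₑ ^ 2 * hs e a := by
  unfold hs
  rw [← ENNReal.tsum_mul_left]
  refine ENNReal.tsum_le_tsum fun i => ?_
  rw [← mul_pow]
  gcongr
  exact b.le_opENorm _

lemma hs_comp_right_le [CompleteSpace H] (e : HilbertBasis ι ℂ H) (a b : H →L[ℂ] H) :
    hs e (a ∘L b) ≤ ‖b‖ₑ ^ 2 * hs e a := by
  rw [← hs_adjoint e e (a ∘L b), ← hs_adjoint e e a, adjoint_comp]
  refine (hs_comp_left_le e _ _).trans_eq ?_
  rw [← ofReal_norm, ← ofReal_norm, LinearIsometryEquiv.norm_map]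

lemma hs_ne_top_iff (e : HilbertBasis ι ℂ H) (a : H →L[ℂ] H) :
    hs e a ≠ ⊤ ↔ Summable fun i => ‖a (e i)‖ ^ 2 := by
  have h1 : (Summable fun i => ‖a (e i)‖ ^ 2) ↔ Summable fun i => ‖a (e i)‖₊ ^ 2 := by
    rw [← NNReal.summable_coe]
    simp
  rw [h1, ← ENNReal.tsum_coe_ne_top_iff_summable]
  simp [hs, enorm_eq_nnnorm]

lemma hs_toReal (e : HilbertBasis ι ℂ H) (a : H →L[ℂ] H) :
    (hs e a).toReal = ∑' i, ‖a (e i)‖ ^ 2 := by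
  unfold hs
  rw [ENNReal.tsum_toReal_eq (by simp)]
  simp

lemma inner_summable_of_hs (e : HilbertBasis ι ℂ H) (a b : H →L[ℂ] H) (ha : hs e a ≠ ⊤)
    (hb : hs e b ≠ ⊤) : (Summable fun i => ‖a (e i)‖ * ‖b (e i)‖) ∧
      ∑' i, ‖a (e i)‖ * ‖b (e i)‖ ≤ Real.sqrt (hs e a).toReal * Real.sqrt (hs e b).toReal := by
  have h := Real.summable_and_inner_le_Lp_mul_Lq_tsum_of_nonneg Real.HolderConjugate.two_two
    (f := fun i => ‖a (e i)‖) (g := fun i => ‖b (e i)‖) (fun _ => norm_nonneg _)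
    (fun _ => norm_nonneg _) (by simpa using (hs_ne_top_iff e a).1 ha)
    (by simpa using (hs_ne_top_iff e b).1 hb)
  rw [hs_toReal, hs_toReal, Real.sqrt_eq_rpow, Real.sqrt_eq_rpow]
  simpa using h

end HilbertSchmidt

variable {H : Type u} [NormedAddCommGroup H] [InnerProductSpace ℂ H] [CompleteSpace H]

lemma exists_polar (x : H →L[ℂ] H) : ∃ w : H →L[ℂ] H, ‖w‖ ≤ 1 ∧ w ∘L CFC.abs x = x ∧
    adjoint w ∘L x = CFC.abs x := by
  set t : H →L[ℂ] H := CFC.abs x with ht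
  have hsa : adjoint t = t := (CFC.abs_nonneg x).isSelfAdjoint.star_eq
  have htt : t ∘L t = adjoint x ∘L x := CFC.abs_mul_abs x
  have hn : ∀ v, ‖t v‖ = ‖x v‖ := by
    intro v
    have h2 : ‖t v‖ ^ 2 = ‖x v‖ ^ 2 := by
      rw [← inner_self_eq_norm_sq (𝕜 := ℂ), ← inner_self_eq_norm_sq (𝕜 := ℂ)]
      rw [← adjoint_inner_right, hsa, ← adjoint_inner_right x]
      exact congrArg (fun z : H →L[ℂ] H => RCLike.re (inner ℂ v (z v))) htt
    exact (pow_left_inj₀ (norm_nonneg _) (norm_nonneg _) two_ne_zero).1 h2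
  let K : Submodule ℂ H := t.range.topologicalClosure
  have : CompleteSpace K := (Submodule.isClosed_topologicalClosure _).completeSpace_coe
  let j : H →ₗ[ℂ] K := t.toLinearMap.codRestrict K fun v =>
    Submodule.le_topologicalClosure _ ⟨v, rfl⟩
  have hj : DenseRange j := by
    intro y
    have hy : (y : H) ∈ closure (Set.range t) := y.2
    rw [Metric.mem_closure_iff] at hy ⊢
    intro ε hε
    obtain ⟨_, ⟨v, rfl⟩, hv⟩ := hy ε hε
    exact ⟨j v, ⟨v, rfl⟩, hv⟩
  have hb : ∀ v, ‖x.toLinearMap v‖ ≤ 1 * ‖j v‖ := fun v => by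
    rw [one_mul]; exact (hn v).ge
  let w0 : K →L[ℂ] H := x.toLinearMap.extendOfNorm j
  have hw0 : ∀ v, w0 (j v) = x v := fun v => LinearMap.extendOfNorm_eq hj ⟨1, hb⟩ v
  let w : H →L[ℂ] H := w0 ∘L K.orthogonalProjectionOnto
  have hw : ‖w‖ ≤ 1 := by
    refine (opNorm_comp_le _ _).trans ?_
    exact mul_le_one₀ (LinearMap.opNorm_extendOfNorm_le hj zero_le_one hb) (norm_nonneg _)
      (Submodule.orthogonalProjectionOnto_norm_le K)
  have hwt : ∀ v, w (t v) = x v := fun v => by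
    have : K.orthogonalProjectionOnto (t v) = j v :=
      Submodule.orthogonalProjectionOnto_mem_subspace_eq_self (j v)
    change w0 (K.orthogonalProjectionOnto (t v)) = x v
    rw [this, hw0]
  refine ⟨w, hw, ContinuousLinearMap.ext hwt, ContinuousLinearMap.ext fun v => ?_⟩
  change adjoint w (x v) = t v
  rw [← sub_eq_zero, ← norm_eq_zero, ← sq_eq_zero_iff]
  refine le_antisymm ?_ (by positivity)
  have h1 : ‖adjoint w (x v)‖ ≤ ‖x v‖ := by
    refine (le_of_opNorm_le _ (c := 1) ?_ _).trans_eq (one_mul _)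
    rwa [LinearIsometryEquiv.norm_map]
  have h2 : RCLike.re (inner ℂ (adjoint w (x v)) (t v)) = ‖x v‖ ^ 2 := by
    rw [adjoint_inner_left, hwt, inner_self_eq_norm_sq]
  rw [norm_sub_sq (𝕜 := ℂ), h2, hn]
  nlinarith [norm_nonneg (adjoint w (x v))]

variable (H) in
/-- The index set of a chosen orthonormal basis of a Hilbert space. -/
def OnbIndex : Set H := (exists_hilbertBasis ℂ H).choose

variable (H) in
/-- A chosen orthonormal basis of a Hilbert space. -/
def onb : HilbertBasis (OnbIndex H) ℂ H := (exists_hilbertBasis ℂ H).choose_spec.choose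

/-- `x ∈ B(H)` is trace class if `∑_i ⟨e_i, |x| e_i⟩ < ∞`, where `|x| = (x^* x)^{1/2}` and `(e_i)`
is an orthonormal basis (the condition does not depend on the basis). -/
def IsTraceClass (x : H →L[ℂ] H) : Prop :=
  Summable fun i => (inner ℂ (onb H i) (CFC.abs x (onb H i))).re

/-- The trace `∑_i ⟨e_i, x e_i⟩` (it does not depend on the orthonormal basis if `x` is trace
class). -/
def trace (x : H →L[ℂ] H) : ℂ := ∑' i, inner ℂ (onb H i) (x (onb H i))

lemma exists_sqrt (x : H →L[ℂ] H) : ∃ s : H →L[ℂ] H, adjoint s = s ∧ s ∘L s = CFC.abs x ∧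
    ∀ v, (inner ℂ v (CFC.abs x v)).re = ‖s v‖ ^ 2 := by
  have h1 : adjoint (CFC.sqrt (CFC.abs x)) = CFC.sqrt (CFC.abs x) :=
    (CFC.sqrt_nonneg (CFC.abs x)).isSelfAdjoint.star_eq
  have h2 : CFC.sqrt (CFC.abs x) ∘L CFC.sqrt (CFC.abs x) = CFC.abs x :=
    CFC.sqrt_mul_sqrt_self (CFC.abs x) (CFC.abs_nonneg x)
  refine ⟨CFC.sqrt (CFC.abs x), h1, h2, fun v => ?_⟩
  conv_lhs => rw [← h2]
  rw [coe_comp, Function.comp_apply, ← adjoint_inner_left, h1]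
  exact inner_self_eq_norm_sq (𝕜 := ℂ) _

lemma IsTraceClass.exists_bound {x : H →L[ℂ] H} (hx : IsTraceClass x) : ∃ C : ℝ, 0 ≤ C ∧
    ∀ a b : H →L[ℂ] H, (Summable fun i => inner ℂ (a (onb H i)) (x (b (onb H i)))) ∧
      ‖∑' i, inner ℂ (a (onb H i)) (x (b (onb H i)))‖ ≤ C * ‖a‖ * ‖b‖ := by
  obtain ⟨s, hs1, hs2, hs3⟩ := exists_sqrt x
  obtain ⟨w, hw, hwx, -⟩ := exists_polar x
  have hs0 : hs (onb H) s ≠ ⊤ := by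
    rw [hs_ne_top_iff]
    simpa only [IsTraceClass, hs3] using hx
  refine ⟨(hs (onb H) s).toReal, ENNReal.toReal_nonneg, fun a b => ?_⟩
  have e : ∀ v, inner ℂ (a v) (x (b v)) = inner ℂ ((s ∘L (adjoint w ∘L a)) v) ((s ∘L b) v) := by
    intro v
    conv_lhs => rw [← hwx, ← hs2]
    simp only [coe_comp, Function.comp_apply]
    rw [← adjoint_inner_left, ← adjoint_inner_left, hs1]
  have hb := hs_comp_right_le (onb H) s b
  have ha := hs_comp_right_le (onb H) s (adjoint w ∘L a)
  have hwa : ‖adjoint w ∘L a‖ ≤ ‖a‖ := by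
    refine (opNorm_comp_le _ _).trans ?_
    rw [LinearIsometryEquiv.norm_map]
    exact mul_le_of_le_one_left (norm_nonneg _) hw
  have hb0 : ‖b‖ₑ ^ 2 * hs (onb H) s ≠ ⊤ := ENNReal.mul_ne_top (by simp) hs0
  have ha0 : ‖adjoint w ∘L a‖ₑ ^ 2 * hs (onb H) s ≠ ⊤ := ENNReal.mul_ne_top (by simp) hs0
  obtain ⟨h1, h2⟩ := inner_summable_of_hs (onb H) (s ∘L (adjoint w ∘L a)) (s ∘L b)
    (ne_top_of_le_ne_top ha0 ha) (ne_top_of_le_ne_top hb0 hb)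
  simp only [e]
  refine ⟨Summable.of_norm_bounded h1 fun i => norm_inner_le_norm _ _, ?_⟩
  refine (tsum_of_norm_bounded h1.hasSum fun i => norm_inner_le_norm _ _).trans (h2.trans ?_)
  have hb' := ENNReal.toReal_mono hb0 hb
  have ha' := ENNReal.toReal_mono ha0 ha
  simp only [ENNReal.toReal_mul, ENNReal.toReal_pow, toReal_enorm] at ha' hb'
  set S := (hs (onb H) s).toReal
  have hS : 0 ≤ S := ENNReal.toReal_nonneg
  calc _ ≤ Real.sqrt (‖a‖ ^ 2 * S) * Real.sqrt (‖b‖ ^ 2 * S) := by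
        gcongr
        exact ha'.trans (by gcongr)
    _ = (‖a‖ * ‖b‖) * (Real.sqrt S * Real.sqrt S) := by
        rw [Real.sqrt_mul (by positivity), Real.sqrt_mul (by positivity),
          Real.sqrt_sq (norm_nonneg _), Real.sqrt_sq (norm_nonneg _)]
        ring
    _ = S * ‖a‖ * ‖b‖ := by rw [Real.mul_self_sqrt hS]; ring

lemma isTraceClass_of_summable {x : H →L[ℂ] H} (h : ∀ a : H →L[ℂ] H,
    Summable fun i => (inner ℂ (a (onb H i)) (x (onb H i)))) : IsTraceClass x := by
  obtain ⟨w, -, -, hw⟩ := exists_polar x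
  have h1 := Complex.hasSum_re (h w).hasSum |>.summable
  refine h1.congr fun i => ?_
  conv_rhs => rw [← hw]
  rw [coe_comp, Function.comp_apply, adjoint_inner_right]

variable (H) in
/-- The space `T(H) ⊆ B(H)` of trace-class operators. -/
def TraceClass : Submodule ℂ (H →L[ℂ] H) where
  carrier := {x | IsTraceClass x}
  add_mem' {x y} hx hy := by
    obtain ⟨_, _, h1⟩ := IsTraceClass.exists_bound hx
    obtain ⟨_, _, h2⟩ := IsTraceClass.exists_bound hy
    refine isTraceClass_of_summable fun a => ?_
    exact ((h1 a (.id ℂ H)).1.add (h2 a (.id ℂ H)).1).congr fun i => by simp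
  zero_mem' := isTraceClass_of_summable fun a => by simp
  smul_mem' c x hx := by
    obtain ⟨_, _, h1⟩ := IsTraceClass.exists_bound hx
    refine isTraceClass_of_summable fun a => ?_
    refine ((h1 a (.id ℂ H)).1.mul_left c).congr fun i => ?_
    simp

lemma TraceClass.summable (x : TraceClass H) (a b : H →L[ℂ] H) :
    Summable fun i => inner ℂ (a (onb H i)) (x.1 (b (onb H i))) := by
  obtain ⟨_, _, h1⟩ := IsTraceClass.exists_bound x.2
  exact (h1 a b).1

lemma TraceClass.summable_trace (x : TraceClass H) (b : H →L[ℂ] H) :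
    Summable fun i => inner ℂ (onb H i) ((x.1 ∘L b) (onb H i)) :=
  TraceClass.summable x (.id ℂ H) b

/-- The bilinear pairing `(x, b) ↦ tr(x b)` on `T(H) × B(H)`. -/
def tracePairing : TraceClass H →ₗ[ℂ] (H →L[ℂ] H) →ₗ[ℂ] ℂ :=
  LinearMap.mk₂ ℂ (fun x b => trace (x.1 ∘L b))
    (fun x y b => by
      rw [trace, trace, trace, ← (TraceClass.summable_trace x b).tsum_add (TraceClass.summable_trace y b)]
      exact tsum_congr fun i => by simp)
    (fun c x b => by
      rw [trace, trace, ← (TraceClass.summable_trace x b).tsum_const_smul]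
      exact tsum_congr fun i => by simp)
    (fun x b d => by
      rw [trace, trace, trace, ← (TraceClass.summable_trace x b).tsum_add (TraceClass.summable_trace x d)]
      exact tsum_congr fun i => by simp)
    (fun c x b => by
      rw [trace, trace, ← (TraceClass.summable_trace x b).tsum_const_smul]
      exact tsum_congr fun i => by simp)

lemma tracePairing_apply (x : TraceClass H) (b : H →L[ℂ] H) :
    tracePairing x b = ∑' i, inner ℂ (onb H i) (x.1 (b (onb H i))) := rfl

lemma exists_tracePairing_le (x : TraceClass H) :
    ∃ C : ℝ, 0 ≤ C ∧ ∀ b, ‖tracePairing x b‖ ≤ C * ‖b‖ := by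
  obtain ⟨C, hC, h⟩ := IsTraceClass.exists_bound x.2
  refine ⟨C, hC, fun b => ((h (.id ℂ H) b).2).trans ?_⟩
  have : ‖ContinuousLinearMap.id ℂ H‖ ≤ 1 := norm_id_le
  rw [mul_assoc]
  exact mul_le_mul_of_nonneg_left (mul_le_of_le_one_left (norm_nonneg _) this) hC

lemma tracePairing_rankOne (x : TraceClass H) (u v : H) :
    tracePairing x (InnerProductSpace.rankOne ℂ v u) = inner ℂ u (x.1 v) := by
  rw [tracePairing_apply, ← (onb H).tsum_inner_mul_inner]
  refine tsum_congr fun i => ?_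
  simp

/-- The operator `∑_{i ∈ F} b e_i ⊗ (a e_i)^*`. -/
def finOp (F : Finset (OnbIndex H)) (a b : H →L[ℂ] H) : H →L[ℂ] H :=
  ∑ i ∈ F, InnerProductSpace.rankOne ℂ (b (onb H i)) (a (onb H i))

lemma tracePairing_finOp (x : TraceClass H) (F : Finset (OnbIndex H)) (a b : H →L[ℂ] H) :
    tracePairing x (finOp F a b) = ∑ i ∈ F, inner ℂ (a (onb H i)) (x.1 (b (onb H i))) := by
  simp [finOp, tracePairing_rankOne]

lemma norm_finOp_le (F : Finset (OnbIndex H)) (a b : H →L[ℂ] H) :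
    ‖finOp F a b‖ ≤ ‖a‖ * ‖b‖ := by
  refine opNorm_le_bound _ (by positivity) fun v => ?_
  have e : finOp F a b v = b (∑ i ∈ F, inner ℂ (onb H i) (adjoint a v) • onb H i) := by
    simp [finOp, adjoint_inner_right]
  have h : ‖∑ i ∈ F, inner ℂ (onb H i) (adjoint a v) • onb H i‖ ≤ ‖adjoint a v‖ := by
    refine le_of_sq_le_sq ?_ (norm_nonneg _)
    refine le_trans (le_of_eq ?_) ((onb H).orthonormal.sum_inner_products_le (s := F) (adjoint a v))
    have h1 := (onb H).orthonormal.inner_sum (fun i => inner ℂ (onb H i) (adjoint a v))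
      (fun i => inner ℂ (onb H i) (adjoint a v)) F
    rw [← inner_self_eq_norm_sq (𝕜 := ℂ), h1]
    simp only [Complex.conj_mul', ← Complex.ofReal_pow, ← Complex.ofReal_sum]
    rfl
  rw [e]
  calc _ ≤ ‖b‖ * ‖∑ i ∈ F, inner ℂ (onb H i) (adjoint a v) • onb H i‖ := b.le_opNorm _
    _ ≤ ‖b‖ * (‖a‖ * ‖v‖) := by
        gcongr
        refine h.trans (((adjoint a).le_opNorm v).trans_eq ?_)
        rw [LinearIsometryEquiv.norm_map]
    _ = _ := by ring

/-- The operator on the Hilbert space `H^{⊕m}` given by an `m × m` matrix over `B(H)`. -/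
def blockOp {m : ℕ} (b : Matrix (Fin m) (Fin m) (H →L[ℂ] H)) :
    PiLp 2 (fun _ : Fin m => H) →L[ℂ] PiLp 2 (fun _ : Fin m => H) :=
  (PiLp.continuousLinearEquiv 2 ℂ (fun _ : Fin m => H)).symm.toContinuousLinearMap ∘L
    ContinuousLinearMap.pi fun k => ∑ l, b k l ∘L PiLp.proj 2 (fun _ : Fin m => H) l

set_option linter.unusedSectionVars false in
lemma blockOp_apply {m : ℕ} (b : Matrix (Fin m) (Fin m) (H →L[ℂ] H))
    (v : PiLp 2 (fun _ : Fin m => H)) (k : Fin m) : blockOp b v k = ∑ l, b k l (v l) := by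
  simp [blockOp]

variable (H) in
/-- A test on `T(H)`: an element of the closed unit ball of `M_m(B(H)) = B(H^{⊕m})`. -/
structure TraceTest where
  /-- the matrix size -/
  size : ℕ
  /-- the matrix over `B(H)` -/
  op : Matrix (Fin size) (Fin size) (H →L[ℂ] H)
  norm_le : ‖blockOp op‖ ≤ 1

/-- The linear map `T(H) → M_m`, `x ↦ [tr(x b_{kl})]`. -/
def TraceTest.toLinearMap (t : TraceTest H) :
    TraceClass H →ₗ[ℂ] Matrix (Fin t.size) (Fin t.size) ℂ where
  toFun x := Matrix.of fun k l => tracePairing x (t.op k l)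
  map_add' x y := by ext; simp
  map_smul' c x := by ext; simp

lemma TraceTest.norm_toLinearMap_le (t : TraceTest H) (x : TraceClass H) {C : ℝ} (hC : 0 ≤ C)
    (h : ∀ b, ‖tracePairing x b‖ ≤ C * ‖b‖) : ‖t.toLinearMap x‖ ≤ C := by
  refine l2_norm_le _ hC fun v => ?_
  set w := (t.toLinearMap x).mulVec v with hw
  set c : H →L[ℂ] H := ∑ k, ∑ l, (star (w k) * v l) • t.op k l with hc
  set S := Real.sqrt (∑ i, ‖w i‖ ^ 2) with hS
  set T := Real.sqrt (∑ i, ‖v i‖ ^ 2) with hT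
  have hS2 : ∑ i, ‖w i‖ ^ 2 = S ^ 2 := (Real.sq_sqrt (by positivity)).symm
  have hT2 : ∑ i, ‖v i‖ ^ 2 = T ^ 2 := (Real.sq_sqrt (by positivity)).symm
  have hS0 : 0 ≤ S := Real.sqrt_nonneg _
  have hT0 : 0 ≤ T := Real.sqrt_nonneg _
  have h1 : tracePairing x c = ((S ^ 2 : ℝ) : ℂ) := by
    rw [← hS2, Complex.ofReal_sum]
    simp only [hc, map_sum, map_smul, smul_eq_mul]
    refine Finset.sum_congr rfl fun k _ => ?_
    have : w k = ∑ l, tracePairing x (t.op k l) * v l := rfl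
    rw [Complex.ofReal_pow, ← Complex.conj_mul' (w k), ← Complex.star_def]
    refine Eq.trans ?_ (congrArg (fun z => star (w k) * z) this).symm
    rw [Finset.mul_sum]
    exact Finset.sum_congr rfl fun l _ => by ring
  have h2 : ‖c‖ ≤ S * T := by
    refine opNorm_le_bound _ (by positivity) fun z => ?_
    let V : PiLp 2 (fun _ : Fin t.size => H) := WithLp.toLp 2 fun l => v l • z
    have hV : ‖V‖ ≤ T * ‖z‖ := by
      rw [PiLp.norm_eq_of_L2]
      refine Real.sqrt_le_iff.2 ⟨by positivity, le_of_eq ?_⟩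
      simp only [V, norm_smul, mul_pow, ← Finset.sum_mul, hT2]
    have hBV : ‖blockOp t.op V‖ ≤ T * ‖z‖ :=
      ((blockOp t.op).le_of_opNorm_le t.norm_le V).trans ((one_mul _).trans_le hV)
    have hcz : c z = ∑ k, star (w k) • blockOp t.op V k := by
      simp [hc, blockOp_apply, V, Finset.smul_sum, smul_smul]
    calc ‖c z‖ ≤ ∑ k, ‖w k‖ * ‖blockOp t.op V k‖ := by
          rw [hcz]
          refine (norm_sum_le _ _).trans (le_of_eq ?_)
          exact Finset.sum_congr rfl fun k _ => by rw [norm_smul, norm_star]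
      _ ≤ S * ‖blockOp t.op V‖ := by
          rw [PiLp.norm_eq_of_L2]
          exact Real.sum_mul_le_sqrt_mul_sqrt _ _ _
      _ ≤ S * (T * ‖z‖) := by gcongr
      _ = S * T * ‖z‖ := by ring
  have h3 : S ^ 2 ≤ C * (S * T) := by
    have h4 := h c
    rw [h1, Complex.norm_real, Real.norm_of_nonneg (by positivity)] at h4
    exact h4.trans (by gcongr)
  rw [hS2, hT2, ← mul_pow]
  refine pow_le_pow_left₀ hS0 ?_ 2
  rcases hS0.eq_or_lt with h | h
  · rw [← h]; positivity
  · nlinarith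

lemma tracePairing_le_of_test {x : TraceClass H} {C : ℝ}
    (h : ∀ t : TraceTest H, ‖t.toLinearMap x‖ ≤ C) (b : H →L[ℂ] H) :
    ‖tracePairing x b‖ ≤ C * ‖b‖ := by
  rcases eq_or_ne b 0 with rfl | hb
  · simp
  have hb0 : 0 < ‖b‖ := norm_pos_iff.2 hb
  let d : H →L[ℂ] H := ((‖b‖⁻¹ : ℝ) : ℂ) • b
  have hd : ‖d‖ ≤ 1 := by
    simp only [d, norm_smul, Complex.norm_real, norm_inv, norm_norm]
    exact (inv_mul_cancel₀ hb0.ne').le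
  let t : TraceTest H := ⟨1, single d, opNorm_le_bound _ zero_le_one fun v => by
    rw [PiLp.norm_eq_of_L2, PiLp.norm_eq_of_L2, one_mul]
    refine Real.sqrt_le_sqrt ?_
    simp only [blockOp_apply, Fin.sum_univ_one]
    refine pow_le_pow_left₀ (norm_nonneg _) ?_ 2
    exact (d.le_of_opNorm_le hd _).trans_eq (one_mul _)⟩
  have h1 : ‖tracePairing x d‖ ≤ C := (norm_entry_le (t.toLinearMap x) 0 0).trans (h t)
  simp only [d, map_smul, norm_smul, Complex.norm_real, norm_inv, norm_norm] at h1
  rwa [inv_mul_le_iff₀ hb0, mul_comm] at h1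

lemma norm_le_of_tracePairing_le {x : TraceClass H} {C : ℝ} (hC : 0 ≤ C)
    (h : ∀ b, ‖tracePairing x b‖ ≤ C * ‖b‖) : ‖x.1‖ ≤ C := by
  refine opNorm_le_bound _ hC fun v => ?_
  have h1 := h (InnerProductSpace.rankOne ℂ v (x.1 v))
  rw [tracePairing_rankOne, InnerProductSpace.norm_rankOne, inner_self_eq_norm_sq_to_K] at h1
  have h2 : ‖x.1 v‖ ^ 2 ≤ C * (‖v‖ * ‖x.1 v‖) := by simpa using h1
  rcases (norm_nonneg (x.1 v)).eq_or_lt with h | h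
  · rw [← h]; positivity
  · nlinarith

lemma traceClass_complete (a : ℕ → TraceClass H)
    (ha : ∀ ε : ℝ, 0 < ε → ∃ N, ∀ p ≥ N, ∀ q ≥ N, ∀ b,
      ‖tracePairing (a p - a q) b‖ ≤ ε * ‖b‖) :
    ∃ x : TraceClass H, ∀ ε : ℝ, 0 < ε → ∃ N, ∀ p ≥ N, ∀ b,
      ‖tracePairing (a p - x) b‖ ≤ ε * ‖b‖ := by
  have hc : CauchySeq fun p => (a p).1 := Metric.cauchySeq_iff.2 fun ε hε => by
    obtain ⟨N, hN⟩ := ha (ε / 2) (half_pos hε)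
    refine ⟨N, fun p hp q hq => ?_⟩
    rw [dist_eq_norm]
    exact (norm_le_of_tracePairing_le (half_pos hε).le (hN p hp q hq)).trans_lt
      (half_lt_self hε)
  obtain ⟨x, hx⟩ := cauchySeq_tendsto_of_complete hc
  have hxv : ∀ v, Filter.Tendsto (fun q => (a q).1 v) Filter.atTop (nhds (x v)) := fun v =>
    ((ContinuousLinearMap.apply ℂ H v).continuous.tendsto x).comp hx
  have key : ∀ ε : ℝ, 0 < ε → ∃ N, ∀ p ≥ N, ∀ (F : Finset (OnbIndex H)) (c b : H →L[ℂ] H),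
      ‖∑ i ∈ F, inner ℂ (c (onb H i)) (((a p).1 - x) (b (onb H i)))‖ ≤ ε * (‖c‖ * ‖b‖) := by
    intro ε hε
    obtain ⟨N, hN⟩ := ha ε hε
    refine ⟨N, fun p hp F c b => ?_⟩
    have hl : Filter.Tendsto
        (fun q => ‖∑ i ∈ F, inner ℂ (c (onb H i)) (((a p).1 - (a q).1) (b (onb H i)))‖)
        Filter.atTop
        (nhds ‖∑ i ∈ F, inner ℂ (c (onb H i)) (((a p).1 - x) (b (onb H i)))‖) := by
      refine (tendsto_finsetSum _ fun i _ => ?_).norm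
      exact Filter.Tendsto.inner tendsto_const_nhds (tendsto_const_nhds.sub (hxv _))
    refine le_of_tendsto hl ?_
    filter_upwards [Filter.eventually_ge_atTop N] with q hq
    have h1 := hN p hp q hq (finOp F c b)
    rw [tracePairing_finOp] at h1
    exact h1.trans (mul_le_mul_of_nonneg_left (norm_finOp_le F c b) hε.le)
  have htc : IsTraceClass x := by
    obtain ⟨N, hN⟩ := key 1 one_pos
    have h1 : IsTraceClass ((a N).1 - x) := by
      obtain ⟨w, hw, -, hwx⟩ := exists_polar ((a N).1 - x)
      obtain ⟨s, -, -, hs⟩ := exists_sqrt ((a N).1 - x)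
      refine summable_of_sum_le (c := 1) (fun i => by
        rw [hs]; positivity) fun F => ?_
      have h2 := hN N le_rfl F w (.id ℂ H)
      have h3 : ∑ i ∈ F, (inner ℂ (onb H i) (CFC.abs ((a N).1 - x) (onb H i))).re
          = (∑ i ∈ F, inner ℂ (w (onb H i)) (((a N).1 - x) (onb H i))).re := by
        rw [Complex.re_sum]
        refine Finset.sum_congr rfl fun i _ => ?_
        conv_lhs => rw [← hwx]
        rw [coe_comp, Function.comp_apply, adjoint_inner_right]
      rw [h3]
      refine (Complex.re_le_norm _).trans (h2.trans ?_)
      rw [one_mul]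
      exact mul_le_one₀ hw (norm_nonneg _) norm_id_le
    have h2 := (TraceClass H).sub_mem (a N).2 h1
    rwa [sub_sub_cancel] at h2
  refine ⟨⟨x, htc⟩, fun ε hε => ?_⟩
  obtain ⟨N, hN⟩ := key ε hε
  refine ⟨N, fun p hp b => ?_⟩
  have h1 := (TraceClass.summable (a p - ⟨x, htc⟩ : TraceClass H) (.id ℂ H) b).hasSum.norm
  refine le_of_tendsto h1 (Filter.Eventually.of_forall fun F => ?_)
  refine (hN p hp F (.id ℂ H) b).trans (mul_le_mul_of_nonneg_left ?_ hε.le)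
  exact mul_le_of_le_one_left (norm_nonneg _) norm_id_le

/-- The operator space structure on `T(H)`, inherited from the embedding
`T(H) → B(H)^*`, `x ↦ tr(x ·)`, where `M_n(B(H)^*) = CB(B(H), M_n)`: for `x ∈ 𝕄_n(T(H))`, the norm
`‖x‖_n` is the supremum of the operator norms of `[tr(x_{ij} b_{kl})]` over all `m` and all
`b ∈ M_m(B(H))` with `‖b‖ ≤ 1`. -/
instance traceClassOperatorSpace : OperatorSpace (TraceClass H) :=
  ofTests (fun t : TraceTest H => t.toLinearMap)
    (fun x => by
      obtain ⟨C, hC, h⟩ := exists_tracePairing_le x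
      exact ⟨C, fun t => t.norm_toLinearMap_le x hC h⟩)
    (fun x hx => by
      have h := norm_le_of_tracePairing_le le_rfl
        (tracePairing_le_of_test (C := 0) fun t => by rw [hx t, norm_zero])
      exact Subtype.ext (norm_le_zero_iff.1 h))
    (fun a ha => by
      obtain ⟨x, hx⟩ := traceClass_complete a fun ε hε => by
        obtain ⟨N, hN⟩ := ha ε hε
        exact ⟨N, fun p hp q hq => tracePairing_le_of_test (hN p hp q hq)⟩
      refine ⟨x, fun ε hε => ?_⟩
      obtain ⟨N, hN⟩ := hx ε hε
      exact ⟨N, fun p hp t => t.norm_toLinearMap_le _ hε.le (hN p hp)⟩)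

end TraceClass

/-- The operator space `T(H)` of trace-class operators on a Hilbert space `H`. -/
def OS.traceClass (H : Type u) [NormedAddCommGroup H] [InnerProductSpace ℂ H] [CompleteSpace H] :
    OS.{u} := ⟨TraceClass H⟩

/-- The finite-dimensional trace-class operator space `T_n = T(ℂ^n)`. The index type is lifted to
the universe of the operator spaces under consideration. -/
def OS.T (n : ℕ) : OS.{u} := OS.traceClass (EuclideanSpace ℂ (ULift.{u} (Fin n)))

/-- The Hilbert space `ℓ₂ = ℓ²(ℕ)`, with index type lifted to the universe `u`. -/
abbrev Ell2 : Type u := lp (fun _ : ULift.{u} ℕ => ℂ) 2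

end OpSpace
end

/-! Under the duality between `T_n` and `M_n`, complete contractions `T_n → X` correspond to
elements of the closed unit ball of `𝕄_n(X)`. Thus maps out of the `T_n` see all vectors of `X` (`n
= 1`) and all matrix norms. A monomorphism is injective, because maps out of `T_1` detect its
kernel. If moreover every map from every `T_n` into the codomain factors through it, then it carries
unit balls onto unit balls at each matrix level, so it is bijective and its inverse is completely
contractive.

Only existence is used: an object needs a contractive matrix `w` in `𝕄_n(S)` which complete
contractions can send to any other contractive matrix (`HasUniversalMatrix`). In `T(H)`, the rank
one operators built from `n` orthonormal vectors form such a `w`; this covers `T_n` and `T(ℓ₂)`. The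
property passes from a retract to the ambient object, which covers the `ℓ¹`-sum.

The analytic point is that a contractive `x ∈ 𝕄_n(X)` induces a complete contraction `T(H) → X`
(`isCompleteContraction_ofMatrix`). Composing it with a complete contraction `φ : X → M_k` gives
pairing with a contractive matrix over `B(H)`, hence one of the tests that define the norm of
`T(H)`. It remains to know that such `φ` determine the norm of `𝕄_k(X)`, a matricial Hahn–Banach
theorem in the manner of Ruan and Effros (`exists_norming_completeContraction`). A norming
functional `F` on `𝕄_k(X)` is dominated by two positive functionals `p`, `q` on `M_k`, obtained by
separating convex sets. Factoring small perturbations of `p` and `q` through invertible matrices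
turns `F` into a vector functional of some `φ`. -/

noncomputable section

namespace OpSpace

open scoped Matrix.Norms.L2Operator

open OperatorSpace

open scoped Matrix

/-! ### Rectangular scalar multiplication -/

section Rectangular

variable {X : Type*} [AddCommGroup X] [Module ℂ X] {k r r₁ r₂ : ℕ}

/-- The product `α v β ∈ 𝕄_k(X)` of `v ∈ 𝕄_r(X)` with rectangular scalar matrices. -/
def rectMul (α : Matrix (Fin k) (Fin r) ℂ) (v : Matrix (Fin r) (Fin r) X)
    (β : Matrix (Fin r) (Fin k) ℂ) : Matrix (Fin k) (Fin k) X :=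
  Matrix.of fun i j => ∑ a, ∑ b, (α i a * β b j) • v a b

lemma rectMul_one (v : Matrix (Fin k) (Fin k) X) : rectMul 1 v 1 = v := by
  ext i j
  simp [rectMul, Matrix.one_apply]

lemma rectMul_smul_smul (s t : ℂ) (α : Matrix (Fin k) (Fin r) ℂ) (v : Matrix (Fin r) (Fin r) X)
    (β : Matrix (Fin r) (Fin k) ℂ) : rectMul (s • α) v (t • β) = (s * t) • rectMul α v β := by
  ext i j
  simp only [rectMul, Matrix.of_apply, Matrix.smul_apply, Finset.smul_sum, smul_smul, smul_eq_mul]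
  exact Finset.sum_congr rfl fun a _ => Finset.sum_congr rfl fun b _ => by congr 1; ring

/-- Juxtaposition of the columns of two matrices. -/
def hcat (α : Matrix (Fin k) (Fin r₁) ℂ) (β : Matrix (Fin k) (Fin r₂) ℂ) :
    Matrix (Fin k) (Fin (r₁ + r₂)) ℂ :=
  Matrix.of fun i => Fin.append (α i) (β i)

lemma hcat_mul_conjTranspose (α : Matrix (Fin k) (Fin r₁) ℂ) (β : Matrix (Fin k) (Fin r₂) ℂ) :
    hcat α β * (hcat α β)ᴴ = α * αᴴ + β * βᴴ := by
  ext i j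
  simp [hcat, Matrix.mul_apply, Fin.sum_univ_add]

lemma rectMul_hcat (α₁ : Matrix (Fin k) (Fin r₁) ℂ) (α₂ : Matrix (Fin k) (Fin r₂) ℂ)
    (v₁ : Matrix (Fin r₁) (Fin r₁) X) (v₂ : Matrix (Fin r₂) (Fin r₂) X)
    (β₁ : Matrix (Fin k) (Fin r₁) ℂ) (β₂ : Matrix (Fin k) (Fin r₂) ℂ) :
    rectMul (hcat α₁ α₂) (dirSum v₁ v₂) (hcat β₁ β₂)ᴴ
      = rectMul α₁ v₁ β₁ᴴ + rectMul α₂ v₂ β₂ᴴ := by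
  ext i j
  simp [rectMul, hcat, Fin.sum_univ_add, dirSum, finSumFinEquiv]

/-- By the C*-identity the norm of a matrix depends only on its product with its adjoint, and zero
columns do not change that product. -/
lemma norm_hcat_zero_le (α : Matrix (Fin k) (Fin r) ℂ) :
    ‖hcat (0 : Matrix (Fin k) (Fin k) ℂ) α‖ ≤ ‖α‖ := by
  have h := Matrix.l2_opNorm_conjTranspose_mul_self (hcat (0 : Matrix (Fin k) (Fin k) ℂ) α)ᴴ
  have h' := Matrix.l2_opNorm_conjTranspose_mul_self αᴴ
  rw [Matrix.conjTranspose_conjTranspose, hcat_mul_conjTranspose, zero_mul, zero_add] at h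
  rw [Matrix.conjTranspose_conjTranspose] at h'
  rw [h', Matrix.l2_opNorm_conjTranspose, Matrix.l2_opNorm_conjTranspose] at h
  exact (mul_self_inj (norm_nonneg _) (norm_nonneg _)).1 h |>.ge

/-- The square matrix with a single nonzero block `α`, in the upper right corner. -/
def padded (α : Matrix (Fin k) (Fin r) ℂ) : Matrix (Fin (k + r)) (Fin (k + r)) ℂ :=
  Matrix.of fun i j => Fin.addCases (fun a => hcat (0 : Matrix (Fin k) (Fin k) ℂ) α a j)
    (fun _ => 0) i

lemma padded_castAdd (α : Matrix (Fin k) (Fin r) ℂ) (a : Fin k) (j : Fin (k + r)) :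
    padded α (Fin.castAdd r a) j = hcat (0 : Matrix (Fin k) (Fin k) ℂ) α a j := by
  simp [padded]

lemma padded_natAdd (α : Matrix (Fin k) (Fin r) ℂ) (a : Fin r) (j : Fin (k + r)) :
    padded α (Fin.natAdd k a) j = 0 := by
  simp [padded]

lemma norm_padded_le (α : Matrix (Fin k) (Fin r) ℂ) : ‖padded α‖ ≤ ‖α‖ := by
  refine l2_norm_le _ (norm_nonneg _) fun v => ?_
  have h := sum_norm_mulVec_sq_le (hcat (0 : Matrix (Fin k) (Fin k) ℂ) α) v
  refine le_trans (le_of_eq ?_) (h.trans (mul_le_mul_of_nonneg_right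
    (pow_le_pow_left₀ (norm_nonneg _) (norm_hcat_zero_le α) 2) (by positivity)))
  simp [Fin.sum_univ_add, Matrix.mulVec, dotProduct, padded_castAdd, padded_natAdd]

variable [OperatorSpace X]

/-- The axiom concerns square scalar matrices only. Padding everything to size `k + r` makes `α v β
⊕ 0` a square product around `0 ⊕ v`, and the direct sum axiom removes the zero blocks. -/
lemma matNorm_rectMul_le (α : Matrix (Fin k) (Fin r) ℂ) (v : Matrix (Fin r) (Fin r) X)
    (β : Matrix (Fin r) (Fin k) ℂ) : matNorm k (rectMul α v β) ≤ ‖α‖ * matNorm r v * ‖β‖ := by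
  have e : scalarMul (padded α) (dirSum (0 : Matrix (Fin k) (Fin k) X) v) (padded βᴴ)ᴴ
      = dirSum (rectMul α v β) (0 : Matrix (Fin r) (Fin r) X) := by
    ext i j
    refine Fin.addCases (fun a => ?_) (fun a => ?_) i <;>
    refine Fin.addCases (fun b => ?_) (fun b => ?_) j <;>
    simp [scalarMul, rectMul, padded_castAdd, padded_natAdd, hcat, Fin.sum_univ_add, dirSum,
      finSumFinEquiv]
  have h1 : matNorm k (rectMul α v β) ≤ matNorm (k + r) (dirSum (rectMul α v β) 0) := by
    rw [matNorm_dirSum]; exact le_max_left _ _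
  rw [← e] at h1
  refine h1.trans ((matNorm_scalarMul_le _ _ _ _).trans ?_)
  rw [matNorm_dirSum, map_zero, max_eq_right (apply_nonneg _ _), Matrix.l2_opNorm_conjTranspose]
  have h2 : ‖padded βᴴ‖ ≤ ‖β‖ := (norm_padded_le βᴴ).trans_eq (Matrix.l2_opNorm_conjTranspose β)
  have h3 : ‖padded α‖ ≤ ‖α‖ := norm_padded_le α
  have h4 : 0 ≤ matNorm r v := apply_nonneg _ _
  gcongr

end Rectangular

/-! ### Norming functionals and their domination by functionals on scalar matrices -/

section HahnBanach

variable {X : Type*} [AddCommGroup X] [Module ℂ X] [OperatorSpace X] {k : ℕ}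

lemma exists_norming_functional (y : Matrix (Fin k) (Fin k) X) :
    ∃ F : Matrix (Fin k) (Fin k) X →ₗ[ℂ] ℂ, (∀ z, ‖F z‖ ≤ matNorm k z) ∧ F y = (matNorm k y : ℝ) := by
  let : Norm (Matrix (Fin k) (Fin k) X) := ⟨fun z => matNorm k z⟩
  have core : NormedSpace.Core ℂ (Matrix (Fin k) (Fin k) X) :=
    { norm_nonneg := fun z => apply_nonneg (matNorm k) z
      norm_smul := fun c z => map_smul_eq_mul (matNorm k) c z
      norm_triangle := fun z w => map_add_le_add (matNorm k) z w
      norm_eq_zero_iff := fun z => ⟨eq_zero_of_matNorm_eq_zero k z, by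
        rintro rfl; exact map_zero (matNorm k)⟩ }
  let : NormedAddCommGroup (Matrix (Fin k) (Fin k) X) := NormedAddCommGroup.ofCore core
  let : NormedSpace ℂ (Matrix (Fin k) (Fin k) X) := NormedSpace.ofCore core
  obtain ⟨g, hg, hgy⟩ := exists_dual_vector'' ℂ y
  exact ⟨g.toLinearMap, fun z => (g.le_of_opNorm_le hg z).trans_eq (one_mul _), hgy⟩

/-- The convex cone of triples `(α α*, β* β, Re F(α v β))` with `‖v‖ ≤ 1`. -/
def stateCone (F : Matrix (Fin k) (Fin k) X →ₗ[ℂ] ℂ) :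
    Set (Matrix (Fin k) (Fin k) ℂ × Matrix (Fin k) (Fin k) ℂ × ℝ) :=
  {z | ∃ (r : ℕ) (α β : Matrix (Fin k) (Fin r) ℂ) (v : Matrix (Fin r) (Fin r) X),
    matNorm r v ≤ 1 ∧ z = (α * αᴴ, β * βᴴ, (F (rectMul α v βᴴ)).re)}

/-- Juxtaposing the scalar matrices and taking `v₁ ⊕ v₂` adds the triples. This is why the inner
size `r` is left free, and it is where the max-norm of direct sums enters. -/
lemma add_mem_stateCone {F : Matrix (Fin k) (Fin k) X →ₗ[ℂ] ℂ}
    {z w : Matrix (Fin k) (Fin k) ℂ × Matrix (Fin k) (Fin k) ℂ × ℝ}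
    (hz : z ∈ stateCone F) (hw : w ∈ stateCone F) : z + w ∈ stateCone F := by
  obtain ⟨r₁, α₁, β₁, v₁, h₁, rfl⟩ := hz
  obtain ⟨r₂, α₂, β₂, v₂, h₂, rfl⟩ := hw
  refine ⟨r₁ + r₂, hcat α₁ α₂, hcat β₁ β₂, dirSum v₁ v₂, ?_, ?_⟩
  · rw [matNorm_dirSum]; exact max_le h₁ h₂
  · simp [hcat_mul_conjTranspose, rectMul_hcat]

lemma smul_mem_stateCone {F : Matrix (Fin k) (Fin k) X →ₗ[ℂ] ℂ}
    {z : Matrix (Fin k) (Fin k) ℂ × Matrix (Fin k) (Fin k) ℂ × ℝ} {t : ℝ} (ht : 0 ≤ t)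
    (hz : z ∈ stateCone F) : t • z ∈ stateCone F := by
  obtain ⟨r, α, β, v, h, rfl⟩ := hz
  have hs : ((Real.sqrt t : ℝ) : ℂ) * (Real.sqrt t : ℝ) = (t : ℂ) := by
    rw [← Complex.ofReal_mul, Real.mul_self_sqrt ht]
  refine ⟨r, ((Real.sqrt t : ℝ) : ℂ) • α, ((Real.sqrt t : ℝ) : ℂ) • β, v, h, ?_⟩
  have hst : star ((Real.sqrt t : ℝ) : ℂ) = (Real.sqrt t : ℝ) := Complex.conj_ofReal _
  simp only [Matrix.conjTranspose_smul, hst, rectMul_smul_smul, Matrix.smul_mul, Matrix.mul_smul,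
    smul_smul, hs, map_smul, Prod.smul_mk, smul_eq_mul, Complex.re_ofReal_mul]
  rfl

lemma convex_stateCone (F : Matrix (Fin k) (Fin k) X →ₗ[ℂ] ℂ) : Convex ℝ (stateCone F) :=
  fun _ hz _ hw _ _ ha hb _ => add_mem_stateCone (smul_mem_stateCone ha hz)
    (smul_mem_stateCone hb hw)

lemma zero_mem_stateCone (F : Matrix (Fin k) (Fin k) X →ₗ[ℂ] ℂ) : 0 ∈ stateCone F :=
  ⟨0, 0, 0, 0, by simp, by
    have : rectMul (0 : Matrix (Fin k) (Fin 0) ℂ) (0 : Matrix (Fin 0) (Fin 0) X) 0 = 0 := by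
      ext i j; simp [rectMul]
    simp only [this, Matrix.zero_mul, map_zero, Complex.zero_re, Matrix.conjTranspose_zero]
    rfl⟩

lemma norm_mul_conjTranspose_self {r : ℕ} (α : Matrix (Fin k) (Fin r) ℂ) :
    ‖α * αᴴ‖ = ‖α‖ * ‖α‖ := by
  have h := Matrix.l2_opNorm_conjTranspose_mul_self αᴴ
  rwa [Matrix.conjTranspose_conjTranspose, Matrix.l2_opNorm_conjTranspose] at h

/-- A hyperplane separates the open convex set `‖A‖ + ‖B‖ < 2 s` from the cone `stateCone F`.
Normalizing it in the last coordinate yields `p` and `q`: the open set gives the norm bounds, the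
cone gives the domination. -/
lemma exists_dominating_functionals {F : Matrix (Fin k) (Fin k) X →ₗ[ℂ] ℂ}
    (hF : ∀ z, ‖F z‖ ≤ matNorm k z) : ∃ p q : Matrix (Fin k) (Fin k) ℂ →ₗ[ℝ] ℝ,
      (∀ A, p A ≤ ‖A‖) ∧ (∀ A, q A ≤ ‖A‖) ∧
      ∀ (r : ℕ) (α β : Matrix (Fin k) (Fin r) ℂ) (v : Matrix (Fin r) (Fin r) X), matNorm r v ≤ 1 →
        2 * (F (rectMul α v βᴴ)).re ≤ p (α * αᴴ) + q (β * βᴴ) := by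
  let E := Matrix (Fin k) (Fin k) ℂ × Matrix (Fin k) (Fin k) ℂ × ℝ
  let U : Set E := {z | ‖z.1‖ + ‖z.2.1‖ < 2 * z.2.2}
  have hUo : IsOpen U := isOpen_lt (by fun_prop) (by fun_prop)
  have hUc : Convex ℝ U := by
    intro z hz w hw a b ha hb hab
    have h1 : ‖a • z.1 + b • w.1‖ ≤ a * ‖z.1‖ + b * ‖w.1‖ := (norm_add_le _ _).trans_eq (by
      rw [norm_smul, norm_smul, Real.norm_of_nonneg ha, Real.norm_of_nonneg hb])
    have h2 : ‖a • z.2.1 + b • w.2.1‖ ≤ a * ‖z.2.1‖ + b * ‖w.2.1‖ :=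
      (norm_add_le _ _).trans_eq (by
        rw [norm_smul, norm_smul, Real.norm_of_nonneg ha, Real.norm_of_nonneg hb])
    have hz' : ‖z.1‖ + ‖z.2.1‖ < 2 * z.2.2 := hz
    have hw' : ‖w.1‖ + ‖w.2.1‖ < 2 * w.2.2 := hw
    change ‖a • z.1 + b • w.1‖ + ‖a • z.2.1 + b • w.2.1‖ < 2 * (a * z.2.2 + b * w.2.2)
    -- The strict inequality survives only through a positive weight, so `a = 0` is treated apart.
    rcases ha.eq_or_lt with rfl | ha0
    · obtain rfl : b = 1 := by linarith
      linarith
    · nlinarith [mul_lt_mul_of_pos_left hz' ha0, mul_le_mul_of_nonneg_left hw'.le hb]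
  have hdisj : Disjoint U (stateCone F) := by
    rw [Set.disjoint_left]
    rintro _ hz ⟨r, α, β, v, hv, rfl⟩
    have hz' : ‖α * αᴴ‖ + ‖β * βᴴ‖ < 2 * (F (rectMul α v βᴴ)).re := hz
    rw [norm_mul_conjTranspose_self, norm_mul_conjTranspose_self] at hz'
    have h1 : (F (rectMul α v βᴴ)).re ≤ ‖α‖ * ‖β‖ := by
      refine (Complex.re_le_norm _).trans ((hF _).trans ((matNorm_rectMul_le _ _ _).trans ?_))
      rw [Matrix.l2_opNorm_conjTranspose]
      exact mul_le_mul_of_nonneg_right (mul_le_of_le_one_right (norm_nonneg _) hv) (norm_nonneg _)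
    -- Disjointness is the inequality `2 ‖α‖ ‖β‖ ≤ ‖α‖² + ‖β‖²`.
    nlinarith [sq_nonneg (‖α‖ - ‖β‖)]
  obtain ⟨f, u, hfU, hfW⟩ := geometric_hahn_banach_open hUc hUo (convex_stateCone F) hdisj
  have hu : u ≤ 0 := by simpa using hfW 0 (zero_mem_stateCone F)
  have hW : ∀ z ∈ stateCone F, 0 ≤ f z := by
    intro z hz
    by_contra! h
    -- A functional bounded below on a cone is nonnegative there: were `f z` negative, this multiple
    -- of `z` would have value `u - 1`, below the bound `u`.
    have h1 := hfW _ (smul_mem_stateCone (t := (u - 1) / f z)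
      (div_nonneg_of_nonpos (by linarith) h.le) hz)
    rw [map_smul, smul_eq_mul, div_mul_cancel₀ _ h.ne] at h1
    linarith
  set c : ℝ := - f (0, 0, 1) with hc
  have hc0 : 0 < c := by
    have := hfU (0, 0, 1) (by simp [U])
    linarith
  have hsplit : ∀ A B s, f (A, B, s) = f (A, 0, 0) + f (0, B, 0) - s * c := by
    intro A B s
    have h1 : ((A, B, s) : E) = (A, 0, 0) + (0, B, 0) + s • (0, 0, 1) := by simp
    rw [h1, map_add, map_add, map_smul, hc, smul_eq_mul]
    ring
  let p : Matrix (Fin k) (Fin k) ℂ →ₗ[ℝ] ℝ :=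
    (2 / c) • (f.toLinearMap ∘ₗ LinearMap.inl ℝ _ _)
  let q : Matrix (Fin k) (Fin k) ℂ →ₗ[ℝ] ℝ :=
    (2 / c) • (f.toLinearMap ∘ₗ LinearMap.inr ℝ _ _ ∘ₗ LinearMap.inl ℝ _ _)
  have hp : ∀ A, p A = 2 / c * f (A, 0, 0) := fun A => rfl
  have hq : ∀ A, q A = 2 / c * f (0, A, 0) := fun A => rfl
  have key : ∀ A B, f (A, 0, 0) + f (0, B, 0) ≤ (‖A‖ + ‖B‖) / 2 * c := by
    intro A B
    refine le_of_forall_pos_le_add fun ε hε => ?_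
    -- The last coordinate lies just above the boundary value, and the excess `ε / c` contributes
    -- exactly `ε`.
    have h1 := hfU (A, B, (‖A‖ + ‖B‖) / 2 + ε / c) (by
      have : 0 < ε / c := by positivity
      change ‖A‖ + ‖B‖ < 2 * ((‖A‖ + ‖B‖) / 2 + ε / c)
      linarith)
    rw [hsplit, add_mul, div_mul_cancel₀ _ hc0.ne'] at h1
    linarith
  have hf0 : f (0, 0, 0) = 0 := map_zero f
  refine ⟨p, q, fun A => ?_, fun A => ?_, fun r α β v hv => ?_⟩
  · have h := key A 0
    rw [hf0, norm_zero, add_zero, add_zero] at h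
    rw [hp, div_mul_eq_mul_div, div_le_iff₀ hc0]
    linarith
  · have h := key 0 A
    rw [hf0, norm_zero, zero_add, zero_add] at h
    rw [hq, div_mul_eq_mul_div, div_le_iff₀ hc0]
    linarith
  · have h := hW _ ⟨r, α, β, v, hv, rfl⟩
    rw [hsplit] at h
    rw [hp, hq, ← mul_add, div_mul_eq_mul_div, le_div_iff₀ hc0]
    linarith

end HahnBanach

/-! ### Positive functionals as Hilbert–Schmidt norms -/

section Factor

variable {k r : ℕ}

/-- The square of the Hilbert–Schmidt norm of a scalar matrix. -/
def hsSq {ι κ : Type*} [Fintype ι] [Fintype κ] (A : Matrix ι κ ℂ) : ℝ := ∑ i, ∑ j, ‖A i j‖ ^ 2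

lemma trace_conjTranspose_mul_self_eq (A : Matrix (Fin k) (Fin r) ℂ) :
    (Aᴴ * A).trace = (hsSq A : ℝ) := by
  rw [hsSq, Finset.sum_comm]
  simp only [Matrix.trace, Matrix.diag, Matrix.mul_apply, Matrix.conjTranspose_apply,
    Complex.ofReal_sum, Complex.star_def, Complex.conj_mul', Complex.ofReal_pow]

lemma exists_re_trace_eq (p : Matrix (Fin k) (Fin k) ℂ →ₗ[ℝ] ℝ) :
    ∃ P : Matrix (Fin k) (Fin k) ℂ, ∀ A, p A = (P * A).trace.re := by
  let c : Module.Dual ℂ (Matrix (Fin k) (Fin k) ℂ) := Module.Dual.extendRCLike p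
  refine ⟨Matrix.of fun j i => c (Matrix.single i j 1), fun A => ?_⟩
  have h : (c A).re = p A := Module.Dual.re_extendRCLike_apply (𝕜 := ℂ) p A
  rw [← h]
  congr 1
  conv_lhs => rw [Matrix.matrix_eq_sum_single A]
  simp only [map_sum, Matrix.trace, Matrix.diag, Matrix.mul_apply, Matrix.of_apply]
  rw [Finset.sum_comm]
  refine Finset.sum_congr rfl fun i _ => Finset.sum_congr rfl fun j _ => ?_
  have : Matrix.single j i (A j i) = A j i • (Matrix.single j i 1 : Matrix (Fin k) (Fin k) ℂ) := by
    rw [Matrix.smul_single, smul_eq_mul, mul_one]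
  rw [this, map_smul, smul_eq_mul, mul_comm]

-- The functional has a density matrix, which positivity makes positive semidefinite after Hermitian
-- symmetrization; `S` is a factor of the density in the form `S* S`. Adding `δ` times the identity
-- makes the density definite and hence `S` invertible.
open scoped MatrixOrder ComplexOrder in
lemma exists_factor {p : Matrix (Fin k) (Fin k) ℂ →ₗ[ℝ] ℝ}
    (hp : ∀ (r : ℕ) (α : Matrix (Fin k) (Fin r) ℂ), 0 ≤ p (α * αᴴ)) {δ : ℝ} (hδ : 0 < δ) :
    ∃ S : Matrix (Fin k) (Fin k) ℂ, IsUnit S ∧ ∀ (r : ℕ) (α : Matrix (Fin k) (Fin r) ℂ),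
      hsSq (S * α) = p (α * αᴴ) + δ * hsSq α := by
  obtain ⟨P₀, hP₀⟩ := exists_re_trace_eq p
  -- `P₀` need not be Hermitian, but only its values on `α α*` matter, and the Hermitian part has
  -- the same ones.
  let P : Matrix (Fin k) (Fin k) ℂ := (1 / 2 : ℂ) • (P₀ + P₀ᴴ) + (δ : ℂ) • 1
  have hherm : P.IsHermitian := by
    simp only [P, Matrix.IsHermitian, Matrix.conjTranspose_add, Matrix.conjTranspose_smul,
      Matrix.conjTranspose_conjTranspose, Matrix.conjTranspose_one, Complex.star_def,
      Complex.conj_ofReal, map_div₀, map_one, map_ofNat]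
    rw [add_comm P₀ᴴ]
  have hPα : ∀ (r : ℕ) (α : Matrix (Fin k) (Fin r) ℂ),
      (αᴴ * P * α).trace = ((p (α * αᴴ) + δ * hsSq α : ℝ) : ℂ) := by
    intro r α
    have h1 : (αᴴ * P₀ᴴ * α).trace = star (αᴴ * P₀ * α).trace := by
      rw [← Matrix.trace_conjTranspose]
      simp [Matrix.conjTranspose_mul, Matrix.mul_assoc]
    have h2 : (αᴴ * P₀ * α).trace = (P₀ * (α * αᴴ)).trace := by
      rw [Matrix.mul_assoc, Matrix.trace_mul_comm, Matrix.mul_assoc]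
    have h3 : αᴴ * P * α = (1 / 2 : ℂ) • (αᴴ * P₀ * α + αᴴ * P₀ᴴ * α) + (δ : ℂ) • (αᴴ * α) := by
      simp only [P, Matrix.mul_add, Matrix.add_mul, Matrix.mul_smul, Matrix.smul_mul,
        Matrix.mul_one]
    rw [h3, Matrix.trace_add, Matrix.trace_smul, Matrix.trace_smul, Matrix.trace_add, h1, h2,
      trace_conjTranspose_mul_self_eq, hP₀, Complex.star_def, Complex.add_conj]
    push_cast
    simp only [smul_eq_mul]
    ring
  have hpos : P.PosDef := by
    refine .of_dotProduct_mulVec_pos hherm fun x hx => ?_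
    let α : Matrix (Fin k) (Fin 1) ℂ := Matrix.of fun i _ => x i
    have h1 : star x ⬝ᵥ (P *ᵥ x) = (αᴴ * P * α).trace := by
      simp [Matrix.trace, Matrix.mul_assoc, Matrix.mul_apply, dotProduct, Matrix.mulVec, α]
    have h2 : 0 < hsSq α := by
      obtain ⟨i, hi⟩ := Function.ne_iff.1 hx
      refine Finset.sum_pos' (fun _ _ => by positivity) ⟨i, Finset.mem_univ _, ?_⟩
      have : 0 < ‖x i‖ := norm_pos_iff.2 hi
      simp only [α, Matrix.of_apply, Fin.sum_univ_one]
      positivity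
    rw [h1, hPα, Complex.zero_lt_real]
    exact add_pos_of_nonneg_of_pos (hp _ _) (mul_pos hδ h2)
  obtain ⟨S, hS⟩ := CStarAlgebra.nonneg_iff_eq_star_mul_self.1 hpos.posSemidef.nonneg
  refine ⟨S, ?_, fun r α => ?_⟩
  · have h1 : IsUnit P.det := (Matrix.isUnit_iff_isUnit_det _).1 hpos.isUnit
    rw [hS, Matrix.det_mul] at h1
    exact (Matrix.isUnit_iff_isUnit_det _).2 (isUnit_of_mul_isUnit_right h1)
  · have h1 := hPα r α
    rw [hS, Matrix.star_eq_conjTranspose] at h1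
    have h2 : αᴴ * (Sᴴ * S) * α = (S * α)ᴴ * (S * α) := by
      simp [Matrix.conjTranspose_mul, Matrix.mul_assoc]
    rw [h2, trace_conjTranspose_mul_self_eq] at h1
    exact_mod_cast h1

end Factor

/-! ### The matricial Hahn–Banach theorem -/

section Matricial

variable {X : Type*} [AddCommGroup X] [Module ℂ X] {k r : ℕ}

/-- The coefficient matrices of a functional on `𝕄_k(X)`. -/
def coeffMap (F : Matrix (Fin k) (Fin k) X →ₗ[ℂ] ℂ) : X →ₗ[ℂ] Matrix (Fin k) (Fin k) ℂ where
  toFun x := Matrix.of fun i j => F (Matrix.single i j x)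
  map_add' x y := by ext; simp [Matrix.single_add]
  map_smul' c x := by ext; simp [← Matrix.smul_single]

lemma apply_rectMul (F : Matrix (Fin k) (Fin k) X →ₗ[ℂ] ℂ) (α : Matrix (Fin k) (Fin r) ℂ)
    (v : Matrix (Fin r) (Fin r) X) (β : Matrix (Fin r) (Fin k) ℂ) :
    F (rectMul α v β) = ∑ a, ∑ b, (αᵀ * coeffMap F (v a b) * βᵀ) a b := by
  have h : rectMul α v β
      = ∑ a, ∑ b, ∑ j, ∑ i, (α i a * β b j) • Matrix.single i j (v a b) := by
    ext i j
    simp [rectMul, Matrix.sum_apply, Matrix.single_apply, ite_and]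
  rw [h]
  simp only [map_sum, map_smul, smul_eq_mul, Matrix.mul_apply, Finset.sum_mul, coeffMap,
    Matrix.transpose_apply, LinearMap.coe_mk, AddHom.coe_mk, Matrix.of_apply]
  refine Finset.sum_congr rfl fun a _ => Finset.sum_congr rfl fun b _ =>
    Finset.sum_congr rfl fun j _ => Finset.sum_congr rfl fun i _ => by ring

/-- For `w` the conjugate of `M v`, the hypothesis reads `2 ‖M v‖² ≤ ‖M v‖² + ‖v‖²`. The form is
bilinear, hence the conjugate. -/
lemma norm_le_one_of_re_le {ι : Type*} [Fintype ι] [DecidableEq ι] {M : Matrix ι ι ℂ}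
    (h : ∀ w v : ι → ℂ, 2 * (w ⬝ᵥ (M *ᵥ v)).re ≤ ∑ i, ‖w i‖ ^ 2 + ∑ i, ‖v i‖ ^ 2) :
    ‖M‖ ≤ 1 := by
  refine l2_norm_le _ zero_le_one fun v => ?_
  have h1 := h (star (M *ᵥ v)) v
  have h2 : star (M *ᵥ v) ⬝ᵥ (M *ᵥ v) = ((∑ i, ‖(M *ᵥ v) i‖ ^ 2 : ℝ) : ℂ) := by
    simp only [dotProduct, Pi.star_apply, Complex.star_def, Complex.conj_mul', Complex.ofReal_sum,
      Complex.ofReal_pow]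
  rw [h2, Complex.ofReal_re] at h1
  simp only [Pi.star_apply, norm_star] at h1
  linarith

lemma norm_dotProduct_mulVec_le {ι : Type*} [Fintype ι] [DecidableEq ι] (M : Matrix ι ι ℂ)
    (w v : ι → ℂ) :
    ‖w ⬝ᵥ (M *ᵥ v)‖ ≤ ‖M‖ * (Real.sqrt (∑ i, ‖w i‖ ^ 2) * Real.sqrt (∑ i, ‖v i‖ ^ 2)) := by
  have h1 : Real.sqrt (∑ i, ‖(M *ᵥ v) i‖ ^ 2) ≤ ‖M‖ * Real.sqrt (∑ i, ‖v i‖ ^ 2) := by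
    refine (Real.sqrt_le_sqrt (sum_norm_mulVec_sq_le M v)).trans_eq ?_
    rw [Real.sqrt_mul (by positivity), Real.sqrt_sq (norm_nonneg _)]
  calc _ ≤ ∑ i, ‖w i‖ * ‖(M *ᵥ v) i‖ := (norm_sum_le _ _).trans_eq (by simp)
    _ ≤ Real.sqrt (∑ i, ‖w i‖ ^ 2) * Real.sqrt (∑ i, ‖(M *ᵥ v) i‖ ^ 2) :=
        Real.sum_mul_le_sqrt_mul_sqrt _ _ _
    _ ≤ Real.sqrt (∑ i, ‖w i‖ ^ 2) * (‖M‖ * Real.sqrt (∑ i, ‖v i‖ ^ 2)) := by gcongr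
    _ = _ := by ring

/-- Reading `ξ` and `η` as vectors in `ℂ^r ⊗ ℂ^k` turns the coefficient formula for `F` into a form
given by the amplification of `φ`. -/
lemma sum_sandwich (φ : X →ₗ[ℂ] Matrix (Fin k) (Fin k) ℂ) (v : Matrix (Fin r) (Fin r) X)
    (ξ η : Matrix (Fin k) (Fin r) ℂ) :
    ∑ a, ∑ b, (ξᵀ * φ (v a b) * η) a b
      = (fun c : Fin r × Fin k => ξ c.2 c.1) ⬝ᵥ
        (flat (v.map φ) *ᵥ fun c : Fin r × Fin k => η c.2 c.1) := by
  simp only [dotProduct, Fintype.sum_prod_type, Matrix.mul_apply, Matrix.comp_apply,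
    Matrix.map_apply, Matrix.transpose_apply, Finset.sum_mul, Finset.mul_sum, Matrix.mulVec]
  refine Finset.sum_congr rfl fun a _ => ?_
  conv_rhs => rw [Finset.sum_comm]
  refine Finset.sum_congr rfl fun b _ => ?_
  conv_rhs => rw [Finset.sum_comm]
  exact Finset.sum_congr rfl fun j _ => Finset.sum_congr rfl fun i _ => by ring

variable [OperatorSpace X]

/-- The matricial Hahn–Banach theorem: complete contractions into matrix spaces are norming. -/
theorem exists_norming_completeContraction (y : Matrix (Fin k) (Fin k) X) {ε : ℝ} (hε : 0 < ε) :
    ∃ φ : X →ₗ[ℂ] Matrix (Fin k) (Fin k) ℂ, IsCompleteContraction φ ∧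
      matNorm k y ≤ (1 + ε) * matNorm k (y.map φ) := by
  obtain ⟨F, hF, hFy⟩ := exists_norming_functional y
  obtain ⟨p, q, hp, hq, hpq⟩ := exists_dominating_functionals hF
  have hp0 : ∀ (r : ℕ) (α : Matrix (Fin k) (Fin r) ℂ), 0 ≤ p (α * αᴴ) := fun r α => by
    have h : rectMul α (0 : Matrix (Fin r) (Fin r) X) (0 : Matrix (Fin r) (Fin k) ℂ) = 0 := by
      ext; simp [rectMul]
    simpa [h] using hpq r α 0 0 (by simp)
  have hq0 : ∀ (r : ℕ) (α : Matrix (Fin k) (Fin r) ℂ), 0 ≤ q (α * αᴴ) := fun r α => by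
    have h : rectMul (0 : Matrix (Fin k) (Fin r) ℂ) (0 : Matrix (Fin r) (Fin r) X) αᴴ = 0 := by
      ext; simp [rectMul]
    simpa [h] using hpq r 0 α 0 (by simp)
  set N := hsSq (1 : Matrix (Fin k) (Fin k) ℂ) with hN
  have hN0 : 0 ≤ N := Finset.sum_nonneg fun _ _ => Finset.sum_nonneg fun _ _ => by positivity
  -- The perturbation adds at most `δ N ≤ ε` to the squared Hilbert–Schmidt norms of `S` and `T`;
  -- the `+ 1` covers `k = 0`, where `N = 0`.
  have hδ : 0 < ε / (N + 1) := by positivity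
  set δ := ε / (N + 1)
  have hδN : δ * N ≤ ε := by
    have : δ * (N + 1) = ε := div_mul_cancel₀ _ (by positivity)
    linarith
  obtain ⟨S, hSu, hS⟩ := exists_factor hp0 hδ
  obtain ⟨T, hTu, hT⟩ := exists_factor hq0 hδ
  have hnn : ∀ {r : ℕ} (A : Matrix (Fin k) (Fin r) ℂ), 0 ≤ hsSq A := fun A =>
    Finset.sum_nonneg fun _ _ => Finset.sum_nonneg fun _ _ => by positivity
  have hone : ‖(1 : Matrix (Fin k) (Fin k) ℂ)‖ ≤ 1 :=
    l2_norm_le _ zero_le_one fun v => by simp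
  have hS1 : hsSq S ≤ 1 + ε := by
    have h := hS k 1
    rw [Matrix.mul_one, Matrix.conjTranspose_one, Matrix.mul_one] at h
    linarith [hp 1]
  have hT1 : hsSq T ≤ 1 + ε := by
    have h := hT k 1
    rw [Matrix.mul_one, Matrix.conjTranspose_one, Matrix.mul_one] at h
    linarith [hq 1]
  have hSi : S * S⁻¹ = 1 := Matrix.mul_nonsing_inv _ ((Matrix.isUnit_iff_isUnit_det _).1 hSu)
  have hTi : T * T⁻¹ = 1 := Matrix.mul_nonsing_inv _ ((Matrix.isUnit_iff_isUnit_det _).1 hTu)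
  have hSi' : S⁻¹ * S = 1 := Matrix.nonsing_inv_mul _ ((Matrix.isUnit_iff_isUnit_det _).1 hSu)
  have hTi' : T⁻¹ * T = 1 := Matrix.nonsing_inv_mul _ ((Matrix.isUnit_iff_isUnit_det _).1 hTu)
  -- Conjugating the coefficients of `F` by the inverse factors absorbs `p` and `q`: in the
  -- variables `ξ = S α`, `η = T β`, the domination of `F` becomes an estimate by Hilbert–Schmidt
  -- norms.
  let φ : X →ₗ[ℂ] Matrix (Fin k) (Fin k) ℂ :=
    { toFun := fun x => (S⁻¹)ᵀ * coeffMap F x * (T⁻¹ᴴ)ᵀ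
      map_add' := fun x y => by simp [Matrix.mul_add, Matrix.add_mul]
      map_smul' := fun c x => by simp }
  have hφ : ∀ (r : ℕ) (ξ η : Matrix (Fin k) (Fin r) ℂ) (v : Matrix (Fin r) (Fin r) X),
      F (rectMul (S⁻¹ * ξ) v (T⁻¹ * η)ᴴ) = ∑ a, ∑ b, (ξᵀ * φ (v a b) * (ηᴴ)ᵀ) a b := by
    intro r ξ η v
    rw [apply_rectMul]
    simp only [φ, LinearMap.coe_mk, AddHom.coe_mk, Matrix.transpose_mul, Matrix.conjTranspose_mul,
      Matrix.mul_assoc]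
  refine ⟨φ, ?_, ?_⟩
  · have h1 : ∀ (r : ℕ) (v : Matrix (Fin r) (Fin r) X), matNorm r v ≤ 1 →
        ‖flat (v.map φ)‖ ≤ 1 := by
      intro r v hv
      refine norm_le_one_of_re_le fun w u => ?_
      let ξ : Matrix (Fin k) (Fin r) ℂ := Matrix.of fun i a => w (a, i)
      let η : Matrix (Fin k) (Fin r) ℂ := Matrix.of fun i a => star (u (a, i))
      -- Here `p(α α*) ≤ hsSq ξ` and `q(β β*) ≤ hsSq η`, as the `δ` terms in `h3` and `h4` are
      -- nonnegative.
      have h2 := hpq r (S⁻¹ * ξ) (T⁻¹ * η) v hv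
      have h3 := hS r (S⁻¹ * ξ)
      have h4 := hT r (T⁻¹ * η)
      rw [← Matrix.mul_assoc, hSi, Matrix.one_mul] at h3
      rw [← Matrix.mul_assoc, hTi, Matrix.one_mul] at h4
      rw [hφ, sum_sandwich] at h2
      have h5 : hsSq ξ = ∑ i, ‖w i‖ ^ 2 := by
        rw [hsSq, Finset.sum_comm, Fintype.sum_prod_type]
        rfl
      have h6 : hsSq η = ∑ i, ‖u i‖ ^ 2 := by
        rw [hsSq, Finset.sum_comm, Fintype.sum_prod_type]
        simp [η]
      have h7 : (fun c : Fin r × Fin k => (ηᴴ)ᵀ c.2 c.1) = u := by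
        ext c; simp [η]
      have h8 : (fun c : Fin r × Fin k => ξ c.2 c.1) = w := rfl
      rw [h7, h8] at h2
      have h9 := mul_nonneg hδ.le (hnn (S⁻¹ * ξ))
      have h10 := mul_nonneg hδ.le (hnn (T⁻¹ * η))
      linarith
    intro r v
    rw [matNorm_matrix]
    refine le_of_forall_pos_le_add fun t ht => ?_
    have hv0 : 0 ≤ matNorm r v := apply_nonneg _ _
    -- Adding `t > 0` permits division also when `v` has norm zero.
    set s := matNorm r v + t with hs
    have hs0 : 0 < s := by positivity
    have hsn : ‖((s⁻¹ : ℝ) : ℂ)‖ = s⁻¹ := by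
      rw [Complex.norm_real, Real.norm_of_nonneg (by positivity)]
    have h2 := h1 r (((s⁻¹ : ℝ) : ℂ) • v) (by
      rw [map_smul_eq_mul, hsn, inv_mul_le_iff₀ hs0, mul_one]
      linarith)
    rw [Matrix.map_smul _ _ (map_smul φ _), flat_smul, norm_smul, hsn, inv_mul_le_iff₀ hs0,
      mul_one] at h2
    exact h2
  -- With `ξ = S` and `η = T` the scalar factors become identities, so `F y` is a matrix coefficient
  -- of the amplification of `φ` at `y`, between vectors of squared norm at most `1 + ε`.
  · have h1 := hφ k S T y
    rw [hSi', hTi', Matrix.conjTranspose_one, rectMul_one, hFy, sum_sandwich] at h1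
    have h2 := norm_dotProduct_mulVec_le (flat (y.map φ)) (fun c : Fin k × Fin k => S c.2 c.1)
      (fun c : Fin k × Fin k => (Tᴴ)ᵀ c.2 c.1)
    rw [← h1, Complex.norm_real, Real.norm_of_nonneg (apply_nonneg _ _), ← matNorm_matrix] at h2
    refine h2.trans ?_
    rw [mul_comm]
    refine mul_le_mul_of_nonneg_right ?_ (apply_nonneg _ _)
    have h3 : ∑ i : Fin k × Fin k, ‖S i.2 i.1‖ ^ 2 ≤ 1 + ε := by
      rwa [Fintype.sum_prod_type, Finset.sum_comm]
    have h4 : ∑ i : Fin k × Fin k, ‖(Tᴴ)ᵀ i.2 i.1‖ ^ 2 ≤ 1 + ε := by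
      rw [Fintype.sum_prod_type, Finset.sum_comm]
      simpa [hsSq] using hT1
    calc _ ≤ Real.sqrt (1 + ε) * Real.sqrt (1 + ε) := by gcongr
      _ = 1 + ε := Real.mul_self_sqrt (by positivity)

end Matricial

/-! ### Matrix norms are determined by complete contractions -/

section Contractions

variable {X Y : Type*} [AddCommGroup X] [Module ℂ X] [OperatorSpace X] [AddCommGroup Y]
  [Module ℂ Y] [OperatorSpace Y]

lemma matNorm_le_of_forall_completeContraction {k : ℕ} {y : Matrix (Fin k) (Fin k) X} {C : ℝ}
    (h : ∀ φ : X →ₗ[ℂ] Matrix (Fin k) (Fin k) ℂ, IsCompleteContraction φ →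
      matNorm k (y.map φ) ≤ C) : matNorm k y ≤ C := by
  have key : ∀ ε : ℝ, 0 < ε → matNorm k y ≤ (1 + ε) * C := fun ε hε => by
    obtain ⟨φ, hφ, hy⟩ := exists_norming_completeContraction y hε
    exact hy.trans (mul_le_mul_of_nonneg_left (h φ hφ) (by positivity))
  -- `C` carries no sign hypothesis; the estimate with `ε = 1` supplies it.
  have hC : 0 ≤ C := by
    have h1 := (apply_nonneg (matNorm k) y).trans (key 1 one_pos)
    linarith
  refine le_of_forall_pos_le_add fun ε hε => ?_
  have h1 := key (ε / (C + 1)) (by positivity)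
  have h2 : ε / (C + 1) * (C + 1) = ε := div_mul_cancel₀ _ (by positivity)
  have h3 : 0 < ε / (C + 1) := by positivity
  linarith

lemma isCompleteContraction_zero : IsCompleteContraction (0 : X →ₗ[ℂ] Y) := fun n x => by
  have h : x.map (0 : X →ₗ[ℂ] Y) = 0 := by ext; simp
  rw [h, map_zero]
  exact apply_nonneg _ _

end Contractions

/-! ### Universal matrices in trace-class spaces -/

section UniversalMatrix

open ContinuousLinearMap

variable {H : Type u} [NormedAddCommGroup H] [InnerProductSpace ℂ H] {n m : ℕ}

lemma _root_.Orthonormal.norm_sum_smul_sq {f : Fin n → H} (hf : Orthonormal ℂ f) (c : Fin n → ℂ) :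
    ‖∑ i, c i • f i‖ ^ 2 = ∑ i, ‖c i‖ ^ 2 := by
  rw [← inner_self_eq_norm_sq (𝕜 := ℂ), hf.inner_sum]
  simp only [Complex.conj_mul', ← Complex.ofReal_pow, ← Complex.ofReal_sum]
  rfl

/-- The operator with matrix `c` with respect to the family `f`. -/
def matrixOp (f : Fin n → H) (c : Matrix (Fin n) (Fin n) ℂ) : H →L[ℂ] H :=
  ∑ i, ∑ j, c i j • InnerProductSpace.rankOne ℂ (f i) (f j)

variable [CompleteSpace H]

/-- The block operator takes coordinates along `f`, a contraction by Bessel's inequality, then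
applies `flat y` and maps back isometrically onto the span of `f`. -/
lemma norm_blockOp_matrixOp_le {f : Fin n → H} (hf : Orthonormal ℂ f)
    (y : Matrix (Fin n) (Fin n) (Matrix (Fin m) (Fin m) ℂ)) :
    ‖blockOp (Matrix.of fun k l => matrixOp f (Matrix.of fun i j => y i j k l))‖ ≤ ‖flat y‖ := by
  refine opNorm_le_bound _ (norm_nonneg _) fun V => ?_
  set w : Fin n × Fin m → ℂ := fun p => inner ℂ (f p.1) (V p.2)
  have hw : ∑ p, ‖w p‖ ^ 2 ≤ ‖V‖ ^ 2 := by
    rw [PiLp.norm_sq_eq_of_L2, Fintype.sum_prod_type, Finset.sum_comm]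
    exact Finset.sum_le_sum fun l _ => hf.sum_inner_products_le (s := Finset.univ) (V l)
  have h1 : ∀ k, blockOp (Matrix.of fun k l => matrixOp f (Matrix.of fun i j => y i j k l)) V k
      = ∑ i, (flat y *ᵥ w) (i, k) • f i := by
    intro k
    simp only [blockOp_apply, Matrix.of_apply, matrixOp, sum_apply, smul_apply,
      InnerProductSpace.rankOne_apply, Matrix.mulVec, dotProduct, Fintype.sum_prod_type,
      Matrix.comp_apply, Finset.sum_smul, smul_smul]
    rw [Finset.sum_comm]
    refine Finset.sum_congr rfl fun i _ => ?_
    rw [Finset.sum_comm]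
  refine le_of_sq_le_sq ?_ (by positivity)
  rw [PiLp.norm_sq_eq_of_L2]
  simp only [h1, hf.norm_sum_smul_sq]
  rw [Finset.sum_comm, ← Fintype.sum_prod_type' (f := fun i k => ‖(flat y *ᵥ w) (i, k)‖ ^ 2),
    mul_pow]
  exact (sum_norm_mulVec_sq_le (flat y) w).trans (by gcongr)

/-- The rank one operator `w ↦ ⟨u, w⟩ v` as a trace-class operator. -/
def rankOneTC (v u : H) : TraceClass H :=
  ⟨InnerProductSpace.rankOne ℂ v u, isTraceClass_of_summable fun a => by
    -- The trace series against `a` is a Parseval series.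
    refine ((onb H).summable_inner_mul_inner u (adjoint a v)).congr fun i => ?_
    rw [InnerProductSpace.rankOne_apply, inner_smul_right, adjoint_inner_right]⟩

lemma tracePairing_rankOneTC (v u : H) (b : H →L[ℂ] H) :
    tracePairing (rankOneTC v u) b = inner ℂ u (b v) := by
  rw [tracePairing_apply, ← adjoint_inner_left, ← (onb H).tsum_inner_mul_inner]
  refine tsum_congr fun i => ?_
  rw [adjoint_inner_left, ← inner_smul_right]
  rfl

/-- The matrix of rank one operators `f_j f_i^*`, which corresponds to the identity map of `M_n`
under the duality between trace-class operators and matrices. -/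
def unitMatrix (f : Fin n → H) : Matrix (Fin n) (Fin n) (TraceClass H) :=
  Matrix.of fun i j => rankOneTC (f j) (f i)

/-- Pairing with a test `b` gives the scalars `⟨f_i, b_{kl} f_j⟩`, the matrix of the compression of
the block operator to the span of `f` in each coordinate. Compressions do not increase the norm. -/
lemma matNorm_unitMatrix_le {f : Fin n → H} (hf : Orthonormal ℂ f) :
    matNorm n (unitMatrix f) ≤ 1 := by
  refine supNorm_le _ zero_le_one fun t => l2_norm_le _ zero_le_one fun v => ?_
  let V : PiLp 2 (fun _ : Fin t.size => H) := WithLp.toLp 2 fun l => ∑ j, v (j, l) • f j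
  have hV : ‖V‖ ^ 2 = ∑ p, ‖v p‖ ^ 2 := by
    rw [PiLp.norm_sq_eq_of_L2, Fintype.sum_prod_type, Finset.sum_comm]
    exact Finset.sum_congr rfl fun l _ => hf.norm_sum_smul_sq _
  have h1 : ∀ i k, (flat ((unitMatrix f).map t.toLinearMap) *ᵥ v) (i, k)
      = inner ℂ (f i) (blockOp t.op V k) := by
    intro i k
    simp only [Matrix.mulVec, dotProduct, Fintype.sum_prod_type, Matrix.comp_apply,
      Matrix.map_apply, unitMatrix, Matrix.of_apply, TraceTest.toLinearMap, LinearMap.coe_mk,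
      AddHom.coe_mk, tracePairing_rankOneTC, blockOp_apply, V, map_sum, map_smul, inner_sum,
      inner_smul_right]
    rw [Finset.sum_comm]
    exact Finset.sum_congr rfl fun l _ => Finset.sum_congr rfl fun j _ => mul_comm _ _
  have h2 : ‖blockOp t.op V‖ ≤ ‖V‖ := (le_of_opNorm_le _ t.norm_le V).trans_eq (one_mul _)
  rw [one_pow, one_mul, ← hV, Fintype.sum_prod_type, Finset.sum_comm]
  refine le_trans ?_ (pow_le_pow_left₀ (norm_nonneg _) h2 2)
  rw [PiLp.norm_sq_eq_of_L2]
  refine Finset.sum_le_sum fun k _ => ?_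
  simp only [h1]
  exact hf.sum_inner_products_le (s := Finset.univ) _

variable {X : Type*} [AddCommGroup X] [Module ℂ X]

/-- The linear map `T(H) → X` corresponding to a matrix `x ∈ 𝕄_n(X)`. -/
def ofMatrix (f : Fin n → H) (x : Matrix (Fin n) (Fin n) X) : TraceClass H →ₗ[ℂ] X where
  toFun t := ∑ i, ∑ j, inner ℂ (f j) (t.1 (f i)) • x i j
  map_add' s t := by simp [add_smul, Finset.sum_add_distrib]
  map_smul' c t := by simp [Finset.smul_sum, smul_smul]

lemma unitMatrix_map_ofMatrix {f : Fin n → H} (hf : Orthonormal ℂ f)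
    (x : Matrix (Fin n) (Fin n) X) : (unitMatrix f).map (ofMatrix f x) = x := by
  ext i j
  have h : ∀ a b, inner ℂ (f b) ((unitMatrix f i j).1 (f a))
      = if a = i then if b = j then 1 else 0 else 0 := by
    intro a b
    change inner ℂ (f b) (InnerProductSpace.rankOne ℂ (f j) (f i) (f a)) = _
    rw [InnerProductSpace.rankOne_apply, inner_smul_right, orthonormal_iff_ite.1 hf,
      orthonormal_iff_ite.1 hf]
    by_cases h1 : a = i <;> by_cases h2 : b = j <;> simp [h1, h2, Ne.symm]
  simp [ofMatrix, h, ite_smul]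

variable [OperatorSpace X]

/-- By the matricial Hahn–Banach theorem it is enough to bound the composite with each complete
contraction `φ : X → M_k`. Such a composite is pairing with a block operator whose coefficients are
the entries of `φ(x_{ij})`, and this operator is contractive because `x` is. -/
lemma isCompleteContraction_ofMatrix {f : Fin n → H} (hf : Orthonormal ℂ f)
    {x : Matrix (Fin n) (Fin n) X} (hx : matNorm n x ≤ 1) :
    IsCompleteContraction (ofMatrix f x) := by
  refine fun k z => matNorm_le_of_forall_completeContraction fun φ hφ => ?_
  let t : TraceTest H := ⟨k, _, (norm_blockOp_matrixOp_le hf (x.map φ)).trans ((hφ n x).trans hx)⟩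
  have ht : (z.map (ofMatrix f x)).map φ = z.map t.toLinearMap := by
    ext a b k l
    simp [ofMatrix, t, TraceTest.toLinearMap, matrixOp, tracePairing_rankOne, Matrix.sum_apply,
      mul_comm]
  rw [ht]
  exact matNorm_map_le_supNorm (φ := fun t : TraceTest H => t.toLinearMap) (fun x => by
    obtain ⟨C, hC, h⟩ := exists_tracePairing_le x
    exact ⟨C, fun t => t.norm_toLinearMap_le x hC h⟩) k z t

end UniversalMatrix

/-! ### Universal matrices and strong generation -/

/-- `S` has a matrix in the closed unit ball of `𝕄_n(S)` that can be mapped to any other such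
matrix by a complete contraction. -/
def HasUniversalMatrix (n : ℕ) (S : OS.{u}) : Prop :=
  ∃ w : Matrix (Fin n) (Fin n) S, matNorm n w ≤ 1 ∧ ∀ (X : OS.{u}) (x : Matrix (Fin n) (Fin n) X),
    matNorm n x ≤ 1 → ∃ φ : S ⟶ X, w.map φ.toLinearMap = x

lemma hasUniversalMatrix_traceClass {H : Type u} [NormedAddCommGroup H] [InnerProductSpace ℂ H]
    [CompleteSpace H] {n : ℕ} {f : Fin n → H} (hf : Orthonormal ℂ f) :
    HasUniversalMatrix n (OS.traceClass H) :=
  ⟨unitMatrix f, matNorm_unitMatrix_le hf, fun _ x hx =>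
    ⟨⟨ofMatrix f x, isCompleteContraction_ofMatrix hf hx⟩, unitMatrix_map_ofMatrix hf x⟩⟩

lemma hasUniversalMatrix_T (n : ℕ) : HasUniversalMatrix n (OS.T.{u} n) :=
  hasUniversalMatrix_traceClass
    (f := (EuclideanSpace.basisFun (ULift.{u} (Fin n)) ℂ).reindex Equiv.ulift)
    (OrthonormalBasis.orthonormal _)

lemma hasUniversalMatrix_traceClass_ell2 (n : ℕ) :
    HasUniversalMatrix n (OS.traceClass Ell2.{u}) := by
  -- The identity of `ℓ₂` is the coordinate isometry of the standard basis; its first `n` vectors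
  -- serve as `f`.
  let e : HilbertBasis (ULift.{u} ℕ) ℂ Ell2.{u} := ⟨LinearIsometryEquiv.refl ℂ _⟩
  exact hasUniversalMatrix_traceClass
    (e.orthonormal.comp (fun i : Fin n => ULift.up i.val) fun i j h =>
      Fin.ext (ULift.up_injective h))

lemma OS.Hom.toLinearMap_comp {X Y Z : OS.{u}} (f : X ⟶ Y) (g : Y ⟶ Z) :
    (f ≫ g).toLinearMap = g.toLinearMap ∘ₗ f.toLinearMap := rfl

/-- The image of the universal matrix under `i` works, since a map on `S` extends to `R` through
`p`. The extension need not be unique, which is why the definition asks for existence only. -/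
lemma HasUniversalMatrix.of_retract {n : ℕ} {S R : OS.{u}} (h : HasUniversalMatrix n S)
    (i : S ⟶ R) (p : R ⟶ S) (hip : i ≫ p = 𝟙 S) : HasUniversalMatrix n R := by
  obtain ⟨w, hw, hu⟩ := h
  refine ⟨w.map i.toLinearMap, (i.isCompleteContraction n w).trans hw, fun X x hx => ?_⟩
  obtain ⟨φ, hφ⟩ := hu X x hx
  refine ⟨p ≫ φ, ?_⟩
  rw [← hφ]
  ext a b
  have h1 : p.toLinearMap (i.toLinearMap (w a b)) = w a b :=
    congrArg (fun g : S ⟶ S => g.toLinearMap (w a b)) hip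
  simp [OS.Hom.toLinearMap_comp, h1]

/-- The zero morphism. -/
def OS.zeroHom (X Y : OS.{u}) : X ⟶ Y := ⟨0, isCompleteContraction_zero⟩

lemma exists_matNorm_smul_le {X : Type*} [AddCommGroup X] [Module ℂ X] [OperatorSpace X] {n : ℕ}
    (x : Matrix (Fin n) (Fin n) X) : ∃ c : ℂ, c ≠ 0 ∧ matNorm n (c • x) ≤ 1 := by
  have h0 : 0 ≤ matNorm n x := apply_nonneg _ _
  refine ⟨(((matNorm n x + 1)⁻¹ : ℝ) : ℂ), ?_, ?_⟩
  · exact_mod_cast inv_ne_zero (by positivity)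
  · rw [map_smul_eq_mul, Complex.norm_real, Real.norm_of_nonneg (by positivity),
      inv_mul_le_iff₀ (by positivity)]
    linarith

/-- A vector in the kernel, scaled into the unit ball, is the value of a map from `T_1`. Its
composite with `m` vanishes, so the map itself is zero, and with it the vector. -/
lemma OS.Hom.injective_of_mono {A B : OS.{u}} (m : A ⟶ B) [Mono m] :
    Function.Injective m.toLinearMap := by
  rw [← LinearMap.ker_eq_bot, LinearMap.ker_eq_bot']
  intro a ha
  obtain ⟨c, hc, hca⟩ := exists_matNorm_smul_le (single a)
  let f : Fin 1 → EuclideanSpace ℂ (ULift.{u} (Fin 1)) :=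
    (EuclideanSpace.basisFun (ULift.{u} (Fin 1)) ℂ).reindex Equiv.ulift
  have hf : Orthonormal ℂ f := OrthonormalBasis.orthonormal _
  let φ : OS.T.{u} 1 ⟶ A := ⟨ofMatrix f (c • single a), isCompleteContraction_ofMatrix hf hca⟩
  have h1 : φ ≫ m = OS.zeroHom _ _ ≫ m := by
    refine OS.Hom.ext (LinearMap.ext fun t => ?_)
    change m.toLinearMap (ofMatrix f (c • single a) t) = m.toLinearMap 0
    simp [ofMatrix, single, ha]
  have h2 : φ = OS.zeroHom _ _ := (cancel_mono m).1 h1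
  have h3 := unitMatrix_map_ofMatrix hf (c • single a)
  have h4 : ofMatrix f (c • single a) = 0 := congrArg OS.Hom.toLinearMap h2
  have h5 : c • a = 0 := by
    have := congrFun (congrFun h3 0) 0
    rw [h4] at this
    exact this.symm
  exact (smul_eq_zero.1 h5).resolve_left hc

/-- A bijective morphism whose amplifications lift elements of the unit balls is invertible. -/
lemma OS.Hom.isIso_of_lift {A B : OS.{u}} (m : A ⟶ B) (hm : Function.Injective m.toLinearMap)
    (h : ∀ (n : ℕ) (b : Matrix (Fin n) (Fin n) B), matNorm n b ≤ 1 →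
      ∃ a : Matrix (Fin n) (Fin n) A, matNorm n a ≤ 1 ∧ a.map m.toLinearMap = b) : IsIso m := by
  have hsurj : Function.Surjective m.toLinearMap := by
    intro b
    obtain ⟨c, hc, hcb⟩ := exists_matNorm_smul_le (single b)
    obtain ⟨a, -, ha⟩ := h 1 _ hcb
    refine ⟨c⁻¹ • a 0 0, ?_⟩
    have h1 : m.toLinearMap (a 0 0) = c • b := congrFun (congrFun ha 0) 0
    rw [map_smul, h1, inv_smul_smul₀ hc]
  let e : A ≃ₗ[ℂ] B := LinearEquiv.ofBijective m.toLinearMap ⟨hm, hsurj⟩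
  have he : ∀ a, e a = m.toLinearMap a := fun a => rfl
  have hcc : IsCompleteContraction e.symm.toLinearMap := by
    intro n b
    refine le_of_forall_pos_le_add fun ε hε => ?_
    have hb0 : 0 ≤ matNorm n b := apply_nonneg _ _
    -- Scaling by `s⁻¹` puts `b` into the unit ball; by injectivity its lift can only be the scaled
    -- image of `b` under the inverse.
    set s := matNorm n b + ε with hs
    have hs0 : 0 < s := by positivity
    have hsn : ‖((s⁻¹ : ℝ) : ℂ)‖ = s⁻¹ := by
      rw [Complex.norm_real, Real.norm_of_nonneg (by positivity)]
    obtain ⟨a, ha, hab⟩ := h n (((s⁻¹ : ℝ) : ℂ) • b) (by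
      rw [map_smul_eq_mul, hsn, inv_mul_le_iff₀ hs0]
      linarith)
    have h1 : a = ((s⁻¹ : ℝ) : ℂ) • b.map e.symm.toLinearMap := by
      rw [← Matrix.map_smul _ _ (map_smul e.symm.toLinearMap _), ← hab]
      ext i j
      exact (e.symm_apply_apply (a i j)).symm
    rw [h1, map_smul_eq_mul, hsn, inv_mul_le_iff₀ hs0, mul_one] at ha
    exact ha
  refine ⟨⟨e.symm.toLinearMap, hcc⟩, ?_, ?_⟩
  · exact OS.Hom.ext (LinearMap.ext fun a => e.symm_apply_apply a)
  · exact OS.Hom.ext (LinearMap.ext fun b => e.apply_symm_apply b)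

/-- Separation needs universal `1 × 1` matrices only, which reach every vector up to a scalar. For a
monomorphism through which all test maps factor, a contractive `b` is the image of `w` under some
`φ`, and the factor `ψ` of `φ` sends `w` to a contractive lift of `b`. -/
theorem isStrongGenerator_of_hasUniversalMatrix {P : ObjectProperty OS.{u}}
    (hP : ∀ n, ∃ S, P S ∧ HasUniversalMatrix n S) : P.IsStrongGenerator := by
  rw [ObjectProperty.isStrongGenerator_iff]
  refine ⟨fun X Y f g h => ?_, fun A B m _ h => ?_⟩
  · refine OS.Hom.ext (LinearMap.ext fun x => ?_)
    obtain ⟨S, hS, w, -, hu⟩ := hP 1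
    obtain ⟨c, hc, hcx⟩ := exists_matNorm_smul_le (single x)
    obtain ⟨φ, hφ⟩ := hu X _ hcx
    have h1 : φ.toLinearMap (w 0 0) = c • x := congrFun (congrFun hφ 0) 0
    have h2 : f.toLinearMap (φ.toLinearMap (w 0 0)) = g.toLinearMap (φ.toLinearMap (w 0 0)) :=
      congrArg (fun k : S ⟶ Y => k.toLinearMap (w 0 0)) (h S hS φ)
    rw [h1, map_smul, map_smul] at h2
    exact smul_right_injective _ hc h2
  · refine m.isIso_of_lift (OS.Hom.injective_of_mono m) fun n b hb => ?_
    obtain ⟨S, hS, w, hw, hu⟩ := hP n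
    obtain ⟨φ, hφ⟩ := hu B b hb
    obtain ⟨ψ, hψ⟩ := h S hS φ
    refine ⟨w.map ψ.toLinearMap, (ψ.isCompleteContraction n w).trans hw, ?_⟩
    rw [← hφ, ← hψ]
    rfl

/-! ### Summands as retracts of the `ℓ¹`-sum -/

section L1Sum

variable {Λ : Type} (X : Λ → OS.{u})

open scoped Classical in
/-- The inclusion of a summand into an `ℓ¹`-direct sum. -/
def OS.l1Incl (l : Λ) : X l ⟶ OS.l1Sum X where
  toLinearMap :=
    { toFun := fun x => lp.single (E := fun l => X l) 1 l x
      map_add' := fun x y => lp.single_add (E := fun l => X l) 1 l x y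
      map_smul' := fun c x => lp.single_smul (𝕜 := ℂ) (E := fun l => X l) 1 l c x }
  isCompleteContraction n x := by
    refine supNorm_le _ (apply_nonneg _ _) fun t => ?_
    refine le_of_eq_of_le (congrArg (matNorm n) (Matrix.ext fun a b => ?_))
      (t.isCompleteContraction l n x)
    change ∑' k, t.map k (lp.single (E := fun l => X l) 1 l (x a b) k) = t.map l (x a b)
    rw [tsum_eq_single l fun k hk => by rw [lp.single_apply_ne _ _ _ hk, map_zero],
      lp.single_apply_self]

open scoped Classical in
/-- The projection of an `ℓ¹`-direct sum onto a summand. -/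
def OS.l1Proj (l : Λ) : OS.l1Sum X ⟶ X l where
  toLinearMap :=
    { toFun := fun y : lp (fun l => X l) 1 => y l
      map_add' := fun _ _ => rfl
      map_smul' := fun _ _ => rfl }
  isCompleteContraction n y := by
    refine matNorm_le_of_forall_completeContraction fun φ hφ => ?_
    -- Extending `φ` by zero on the other summands gives a test on the `ℓ¹`-sum whose value is `φ`
    -- of the `l`-th coordinate.
    let t : L1Test X := ⟨n, Function.update (fun _ => 0) l φ, fun k => by
      by_cases hk : k = l
      · subst hk
        rw [Function.update_self]
        exact hφ
      · rw [Function.update_of_ne hk]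
        exact isCompleteContraction_zero⟩
    refine le_of_eq_of_le (congrArg (matNorm n) (Matrix.ext fun a b => ?_))
      (matNorm_map_le_supNorm (φ := fun t : L1Test X => t.toLinearMap)
        (fun x => ⟨‖x‖, fun t => t.norm_toLinearMap_le x⟩) n y t)
    let z : lp (fun l => X l) 1 := y a b
    change φ (z l) = ∑' k, t.map k (z k)
    rw [tsum_eq_single l fun k hk => by simp [t, Function.update_of_ne hk]]
    simp [t]

lemma OS.l1Incl_l1Proj (l : Λ) : OS.l1Incl X l ≫ OS.l1Proj X l = 𝟙 (X l) := by
  classical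
  refine OS.Hom.ext (LinearMap.ext fun x => ?_)
  exact lp.single_apply_self (E := fun l => X l) 1 l x

end L1Sum

end OpSpace

/-! ### The three strong generators -/

theorem mainTheorem10 :
    (CategoryTheory.ObjectProperty.ofObj
      (fun n : ℕ => (OpSpace.OS.T n : OpSpace.OS.{u}))).IsStrongGenerator ∧
    (CategoryTheory.ObjectProperty.singleton
      (OpSpace.OS.l1Sum (fun n : ℕ => (OpSpace.OS.T n : OpSpace.OS.{u})))).IsStrongGenerator ∧
    (CategoryTheory.ObjectProperty.singleton
      (OpSpace.OS.traceClass OpSpace.Ell2.{u})).IsStrongGenerator := by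
  refine ⟨OpSpace.isStrongGenerator_of_hasUniversalMatrix fun n => ?_,
    OpSpace.isStrongGenerator_of_hasUniversalMatrix fun n => ?_,
    OpSpace.isStrongGenerator_of_hasUniversalMatrix fun n => ?_⟩
  · exact ⟨_, ObjectProperty.ofObj_apply _ n, OpSpace.hasUniversalMatrix_T n⟩
  · exact ⟨_, by simp, (OpSpace.hasUniversalMatrix_T n).of_retract _ _
      (OpSpace.OS.l1Incl_l1Proj (fun n : ℕ => (OpSpace.OS.T n : OpSpace.OS.{u})) n)⟩
  · exact ⟨_, by simp, OpSpace.hasUniversalMatrix_traceClass_ell2 n⟩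

end
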